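/- Let $I\subset\mathbb R$ be an open interval containing $0$ and let $\gamma:I\to\mathbb R^2$ be a $C^\infty$ curve. Put $$A=\det(\gamma^{(5)}(0),\gamma^{(4)}(0)),\quad B=\det(\gamma^{(6)}(0),\gamma^{(4)}(0)),\quad C=\det(\gamma^{(7)}(0),\gamma^{(4)}(0)),\quad D=\det(\gamma^{(6)}(0),\gamma^{(5)}(0)),$$ and, when $\gamma^{(4)}(0)\neq 0$ (in particular when $A\ne 0$), define the $(4,5;\pm7)$-cuspidal curvature $$\kappa_q=\frac{-77B^2+105AD+60AC}{\|\gamma^{(4)}(0)\|^5}.$$ Two plane curves $\gamma_1,\gamma_2$ defined near $0\in\mathbb R$ are called $C^r$-equivalent at $t=0$ if there are $C^r$ diffeomorphism germs $\psi:(\mathbb R,0)\to(\mathbb R,0)$ and $\Psi:(\mathbb R^2,\gamma_1(0))\to(\mathbb R^2,\gamma_2(0))$ such that $\Psi\circ\gamma_1\circ\psi^{-1}=\gamma_2$ near $0$; $C^\infty$-equivalence is called $\mathcal A$-equivalence. Then: 1. $\gamma$ is $\mathcal A$-equivalent at $t=0$ to $(t^4,t^5)$ if and only if $\gamma'(0)=\gamma''(0)=\gamma'''(0)=0$,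 $A\neq0$ and $\kappa_q=0$. 2. $\gamma$ is $\mathcal A$-equivalent at $t=0$ to $(t^4,t^5+t^7)$ if and only if $\gamma'(0)=\gamma''(0)=\gamma'''(0)=0$, $A\neq0$ and $\kappa_q>0$. 3. $\gamma$ is $\mathcal A$-equivalent at $t=0$ to $(t^4,t^5-t^7)$ if and only if $\gamma'(0)=\gamma''(0)=\gamma'''(0)=0$, $A\neq0$ and $\kappa_q<0$. 4. The curves $(t^4,t^5)$, $(t^4,t^5+t^7)$ and $(t^4,t^5-t^7)$ are pairwise not $\mathcal A$-equivalent at $t=0$, but they are pairwise $C^1$-equivalent at $t=0$. -/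

import Mathlib

open scoped Topology ContDiff

/-- The Euclidean plane `ℝ²`. -/
abbrev Plane : Type := EuclideanSpace ℝ (Fin 2)

/-- `f` is a local `C^r` diffeomorphism whose germ maps `(E, p)` to `(F, q)`: a homeomorphism
between an open neighbourhood of `p` and an open neighbourhood of `q`, with `f p = q`, which is
of class `C^r` together with its inverse. -/
def IsDiffeoGerm {E F : Type*} [NormedAddCommGroup E] [NormedSpace ℝ E]
    [NormedAddCommGroup F] [NormedSpace ℝ F] (r : WithTop ℕ∞)
    (f : OpenPartialHomeomorph E F) (p : E) (q : F) : Prop :=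
  p ∈ f.source ∧ f p = q ∧ ContDiffOn ℝ r f f.source ∧ ContDiffOn ℝ r f.symm f.target

/-- `C^r`-equivalence at `t = 0` of the germs of two plane curves `γ₁` and `γ₂`: there are `C^r`
diffeomorphism germs `ψ : (ℝ, 0) → (ℝ, 0)` and `Ψ : (ℝ², γ₁ 0) → (ℝ², γ₂ 0)` such that
`Ψ ∘ γ₁ ∘ ψ⁻¹ = γ₂` as germs at `0`. -/
def CrEquivAtZero (r : WithTop ℕ∞) (γ₁ γ₂ : ℝ → Plane) : Prop :=
  ∃ (ψ : OpenPartialHomeomorph ℝ ℝ) (Ψ : OpenPartialHomeomorph Plane Plane),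
    IsDiffeoGerm r ψ 0 0 ∧ IsDiffeoGerm r Ψ (γ₁ 0) (γ₂ 0) ∧
      ∀ᶠ t in 𝓝 (0 : ℝ), Ψ (γ₁ (ψ.symm t)) = γ₂ t

/-- `𝒜`-equivalence at `t = 0`: equivalence through smooth diffeomorphism germs. -/
def AEquivAtZero (γ₁ γ₂ : ℝ → Plane) : Prop := CrEquivAtZero ∞ γ₁ γ₂

/-- The determinant `det(u, v)` of the matrix with columns `u` and `v`. -/
def planeDet (u v : Plane) : ℝ := Matrix.det !![u 0, v 0; u 1, v 1]

/-- `det(γ⁽ⁱ⁾(0), γ⁽ʲ⁾(0))`. -/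
noncomputable def jetDet (γ : ℝ → Plane) (i j : ℕ) : ℝ :=
  planeDet (iteratedDeriv i γ 0) (iteratedDeriv j γ 0)

/-- `A = det(γ⁽⁵⁾(0), γ⁽⁴⁾(0))`. -/
noncomputable def cuspA (γ : ℝ → Plane) : ℝ := jetDet γ 5 4

/-- `B = det(γ⁽⁶⁾(0), γ⁽⁴⁾(0))`. -/
noncomputable def cuspB (γ : ℝ → Plane) : ℝ := jetDet γ 6 4

/-- `C = det(γ⁽⁷⁾(0), γ⁽⁴⁾(0))`. -/
noncomputable def cuspC (γ : ℝ → Plane) : ℝ := jetDet γ 7 4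

/-- `D = det(γ⁽⁶⁾(0), γ⁽⁵⁾(0))`. -/
noncomputable def cuspD (γ : ℝ → Plane) : ℝ := jetDet γ 6 5

/-- The `(4, 5; ±7)`-cuspidal curvature `κ_q` at `t = 0`; meaningful when `γ⁽⁴⁾(0) ≠ 0`. -/
noncomputable def cuspidalCurvature (γ : ℝ → Plane) : ℝ :=
  (-77 * cuspB γ ^ 2 + 105 * cuspA γ * cuspD γ + 60 * cuspA γ * cuspC γ) /
    ‖iteratedDeriv 4 γ 0‖ ^ 5

/-- `γ'(0) = γ''(0) = γ'''(0) = 0` and `A ≠ 0`. -/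
def IsFourFiveJet (γ : ℝ → Plane) : Prop :=
  iteratedDeriv 1 γ 0 = 0 ∧ iteratedDeriv 2 γ 0 = 0 ∧ iteratedDeriv 3 γ 0 = 0 ∧ cuspA γ ≠ 0

/-- The curve `t ↦ (t⁴, t⁵)`. -/
noncomputable def cusp45 (t : ℝ) : Plane := !₂[t ^ 4, t ^ 5]

/-- The curve `t ↦ (t⁴, t⁵ + t⁷)`. -/
noncomputable def cusp45Plus (t : ℝ) : Plane := !₂[t ^ 4, t ^ 5 + t ^ 7]

/-- The curve `t ↦ (t⁴, t⁵ - t⁷)`. -/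
noncomputable def cusp45Minus (t : ℝ) : Plane := !₂[t ^ 4, t ^ 5 - t ^ 7]

open Filter Asymptotics

/-! Along (t^4, t^5 + c t^7) the monomial x^i y^j has order 4i + 5j, so coordinate changes of the
plane act directly on the orders 8, 9, 10 and on everything from 12 on. The gaps 6 and 11 are closed
by perturbing the first component and then restoring t^4 by a reparametrization, which shifts the
second component. The gap 7 survives: scaling multiplies its coefficient by a positive factor, which
leaves c = 0, 1, -1. This is `IsFourFiveJet.exists_aEquivAtZero_cuspFamily`. From order 12 on the
removal is exact: Whitney's theorem on even functions, used twice, writes the error with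
coefficients smooth in t^4, and a linear system over such functions yields the coordinate change
(`aEquivAtZero_cuspFamily_of_pow_twelve`).

Conversely, for a curve equivalent to `cuspFamily c`, the second-order part of the coordinate change
contributes only O(t^8), so the derivatives of orders 1 to 7 involve only its linear part and the
4-jet of the parameter change. In the numerator of the curvature the higher coefficients of the
parameter change cancel and a positive multiple of c remains (`AEquivAtZero.cuspidalCurvature_eq`).
Hence the sign of the curvature selects the normal form and separates the three models.

The C^1 statement holds because t^7 = y |y|^(2/5) for y = t^5, and this is a C^1 function of y with
zero derivative at 0.

Germs are replaced by globally smooth maps by means of a bump function, so that the calculus takes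
place on the whole space. -/

theorem exists_contDiff_eventuallyEq {E F : Type*} [NormedAddCommGroup E] [NormedSpace ℝ E]
    [HasContDiffBump E] [NormedAddCommGroup F] [NormedSpace ℝ F]
    {n : ℕ∞} {f : E → F} {U : Set E} {x : E} (hU : U ∈ 𝓝 x) (hf : ContDiffOn ℝ n f U) :
    ∃ g : E → F, ContDiff ℝ n g ∧ g =ᶠ[𝓝 x] f := by
  obtain ⟨ε, hε, hball⟩ := Metric.mem_nhds_iff.1 hU
  let χ : ContDiffBump x := ⟨ε / 4, ε / 2, by positivity, by linarith⟩
  refine ⟨fun y => χ y • f y, contDiff_iff_contDiffAt.2 fun y => ?_, ?_⟩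
  · by_cases hy : dist y x < ε
    · have hfy : ContDiffAt ℝ n f y :=
        (hf.mono hball).contDiffAt (Metric.isOpen_ball.mem_nhds hy)
      exact (χ.contDiffAt (x := y)).smul hfy
    · have : (fun y => χ y • f y) =ᶠ[𝓝 y] fun _ => 0 := by
        have hev : ∀ᶠ z in 𝓝 y, ε / 2 < dist z x :=
          continuousAt_id.dist continuousAt_const |>.eventually_const_lt (by simp; linarith)
        filter_upwards [hev] with z hz
        rw [χ.zero_of_le_dist hz.le, zero_smul]
      exact contDiffAt_const.congr_of_eventuallyEq this
  · filter_upwards [χ.eventuallyEq_one] with y hy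
    simp only [hy, Pi.one_apply, one_smul]

/-! ### Hadamard's lemma, Taylor expansion and Borel's lemma on the line -/

/-- Differentiation in t raises the weight s^j by one power, so the family over all j is closed
under it; the induction for smoothness rests on this. -/
theorem hasDerivAt_integral_pow_mul {f : ℝ → ℝ} (hf : ContDiff ℝ 1 f) (j : ℕ) (x : ℝ) :
    HasDerivAt (fun t => ∫ s in (0 : ℝ)..1, s ^ j * f (s * t))
      (∫ s in (0 : ℝ)..1, s ^ (j + 1) * deriv f (s * x)) x := by
  have hf' : Continuous (deriv f) := hf.continuous_deriv le_rfl
  have hfc : Continuous f := hf.continuous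
  obtain ⟨C, hC⟩ := (isCompact_Icc (a := -(|x| + 1)) (b := |x| + 1)).exists_bound_of_continuousOn
    hf'.continuousOn
  refine (intervalIntegral.hasDerivAt_integral_of_dominated_loc_of_deriv_le
    (F := fun t s => s ^ j * f (s * t)) (F' := fun t s => s ^ (j + 1) * deriv f (s * t))
    (s := Metric.ball x 1) (bound := fun _ => C) (Metric.ball_mem_nhds x one_pos) ?_ ?_ ?_ ?_ ?_ ?_).2
  · exact .of_forall fun t => (by fun_prop : Continuous _).aestronglyMeasurable
  · exact (by fun_prop : Continuous _).intervalIntegrable _ _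
  · exact (by fun_prop : Continuous _).aestronglyMeasurable
  · refine .of_forall fun s hs t ht => ?_
    rw [Set.uIoc_of_le zero_le_one] at hs
    have ht' : |t| < |x| + 1 := by
      have := abs_sub_abs_le_abs_sub t x
      rw [Metric.mem_ball, Real.dist_eq] at ht
      linarith
    have hst : |s * t| ≤ |x| + 1 := by
      rw [abs_mul, abs_of_pos hs.1]
      nlinarith [abs_nonneg t, hs.2, hs.1]
    rw [norm_mul, norm_pow, Real.norm_of_nonneg hs.1.le]
    have h1 := hC (s * t) (abs_le.1 hst)
    have h2 : s ^ (j + 1) ≤ 1 := pow_le_one₀ hs.1.le hs.2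
    have h3 : 0 ≤ s ^ (j + 1) := pow_nonneg hs.1.le _
    nlinarith [norm_nonneg (deriv f (s * t))]
  · exact intervalIntegrable_const
  · refine .of_forall fun s _ t _ => ?_
    have hd : HasDerivAt f (deriv f (s * t)) (s * t) :=
      (hf.differentiable one_ne_zero _).hasDerivAt
    exact ((hd.comp t ((hasDerivAt_id t).const_mul s)).const_mul (s ^ j)).congr_deriv (by ring)

theorem contDiff_integral_pow_mul {f : ℝ → ℝ} (hf : ContDiff ℝ ∞ f) (j : ℕ) :
    ContDiff ℝ ∞ fun t => ∫ s in (0 : ℝ)..1, s ^ j * f (s * t) := by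
  refine contDiff_infty.2 fun n => ?_
  induction n generalizing f j with
  | zero =>
    exact contDiff_zero.2 (continuous_iff_continuousAt.2 fun x =>
      (hasDerivAt_integral_pow_mul (hf.of_le (by exact_mod_cast le_top)) j x).continuousAt)
  | succ n ih =>
    have hd := hasDerivAt_integral_pow_mul (hf.of_le (by exact_mod_cast le_top)) j
    have hd' := funext fun x => (hd x).deriv
    push_cast
    refine contDiff_succ_iff_deriv.2 ⟨fun x => (hd x).differentiableAt,
      fun h => absurd h (by simp), ?_⟩
    rw [hd']
    exact ih (contDiff_infty_iff_deriv.1 hf).2 (j + 1)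

/-- Hadamard's lemma on the line. -/
theorem exists_contDiff_eq_add_mul {f : ℝ → ℝ} (hf : ContDiff ℝ ∞ f) :
    ∃ k : ℝ → ℝ, ContDiff ℝ ∞ k ∧ ∀ t, f t = f 0 + t * k t := by
  have hf' : ContDiff ℝ ∞ (deriv f) := (contDiff_infty_iff_deriv.1 hf).2
  refine ⟨_, contDiff_integral_pow_mul hf' 0, fun t => ?_⟩
  have : ∀ s ∈ Set.uIcc (0 : ℝ) 1, HasDerivAt (fun s => f (s * t)) (t * deriv f (s * t)) s := by
    intro s _
    have hd : HasDerivAt f (deriv f (s * t)) (s * t) :=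
      (hf.differentiable (by simp) _).hasDerivAt
    exact (hd.comp s ((hasDerivAt_id s).mul_const t)).congr_deriv (by ring)
  have h := intervalIntegral.integral_eq_sub_of_hasDerivAt this
    (Continuous.intervalIntegrable (by have := hf'.continuous; fun_prop) _ _)
  simp only [one_mul, zero_mul] at h
  simp only [pow_zero, one_mul]
  rw [← intervalIntegral.integral_const_mul, h]
  ring

theorem iteratedDeriv_id_mul_zero {k : ℝ → ℝ} (hk : ContDiff ℝ ∞ k) (n : ℕ) :
    iteratedDeriv (n + 1) (fun t => t * k t) 0 = (n + 1) * iteratedDeriv n k 0 := by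
  rw [iteratedDeriv_fun_mul (f := fun t => t) contDiffAt_id
    (hk.contDiffAt.of_le (by exact_mod_cast le_top))]
  simp only [iteratedDeriv_fun_id_zero]
  rw [Finset.sum_eq_single 1]
  · simp
  · intro b _ hb
    simp [hb]
  · simp

/-- Taylor's formula at `0` with smooth remainder. -/
theorem exists_taylor_remainder {f : ℝ → ℝ} (hf : ContDiff ℝ ∞ f) (N : ℕ) :
    ∃ R : ℝ → ℝ, ContDiff ℝ ∞ R ∧ ∀ t,
      f t = ∑ i ∈ Finset.range N, iteratedDeriv i f 0 / (i.factorial : ℝ) * t ^ i + t ^ N * R t := by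
  induction N generalizing f with
  | zero => exact ⟨f, hf, fun t => by simp⟩
  | succ N ih =>
    obtain ⟨k, hk, hfk⟩ := exists_contDiff_eq_add_mul hf
    obtain ⟨R, hR, hkR⟩ := ih hk
    refine ⟨R, hR, fun t => ?_⟩
    have hcoef : ∀ i : ℕ, iteratedDeriv (i + 1) f 0 / ((i + 1).factorial : ℝ) =
        iteratedDeriv i k 0 / (i.factorial : ℝ) := by
      intro i
      have : f = fun t => f 0 + t * k t := funext hfk
      rw [this, iteratedDeriv_const_add (Nat.succ_pos i), iteratedDeriv_id_mul_zero hk,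
        Nat.factorial_succ]
      push_cast
      field_simp
    rw [Finset.sum_range_succ']
    simp only [hcoef, iteratedDeriv_zero, Nat.factorial_zero, Nat.cast_one, div_one, pow_zero,
      mul_one]
    rw [hfk t, hkR t, mul_add, Finset.mul_sum]
    have : ∑ i ∈ Finset.range N, t * (iteratedDeriv i k 0 / (i.factorial : ℝ) * t ^ i) =
        ∑ i ∈ Finset.range N, iteratedDeriv i k 0 / (i.factorial : ℝ) * t ^ (i + 1) :=
      Finset.sum_congr rfl fun i _ => by ring
    rw [this]
    ring

/-- Uniqueness of Taylor coefficients: the constant term is a limit that must vanish, and division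
by t lowers the order. The punctured neighbourhood permits that division. -/
theorem eq_zero_of_sum_isBigO {N : ℕ} {c : ℕ → ℝ}
    (h : (fun t : ℝ => ∑ i ∈ Finset.range N, c i * t ^ i) =O[𝓝[≠] 0] fun t => t ^ N) :
    ∀ i < N, c i = 0 := by
  induction N generalizing c with
  | zero => simp
  | succ N ih =>
    have h0 : c 0 = 0 := by
      have h1 : Tendsto (fun t : ℝ => ∑ i ∈ Finset.range (N + 1), c i * t ^ i) (𝓝[≠] 0) (𝓝 0) := by
        refine h.trans_tendsto ?_
        have : Tendsto (fun t : ℝ => t ^ (N + 1)) (𝓝 0) (𝓝 (0 ^ (N + 1))) :=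
          (continuous_pow _).tendsto _
        simpa using this.mono_left nhdsWithin_le_nhds
      have h2 : Tendsto (fun t : ℝ => ∑ i ∈ Finset.range (N + 1), c i * t ^ i) (𝓝[≠] 0)
          (𝓝 (∑ i ∈ Finset.range (N + 1), c i * 0 ^ i)) :=
        ((by fun_prop : Continuous fun t : ℝ =>
          ∑ i ∈ Finset.range (N + 1), c i * t ^ i).tendsto 0).mono_left nhdsWithin_le_nhds
      have := tendsto_nhds_unique h2 h1
      simpa [Finset.sum_range_succ'] using this
    have h1 : (fun t : ℝ => ∑ i ∈ Finset.range N, c (i + 1) * t ^ i) =O[𝓝[≠] 0]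
        fun t => t ^ N := by
      have h3 := (isBigO_refl (fun t : ℝ => t⁻¹) (𝓝[≠] 0)).mul h
      refine (h3.congr' ?_ ?_)
      · filter_upwards [self_mem_nhdsWithin] with t ht
        have ht : t ≠ 0 := ht
        rw [Finset.sum_range_succ', h0, zero_mul, add_zero, Finset.mul_sum]
        refine Finset.sum_congr rfl fun i _ => ?_
        field_simp
        ring
      · filter_upwards [self_mem_nhdsWithin] with t ht
        have ht : t ≠ 0 := ht
        field_simp
        ring
    intro i hi
    cases i with
    | zero => exact h0
    | succ i => exact ih h1 i (by omega)

theorem exists_bound_iteratedDeriv_of_hasCompactSupport {p : ℝ → ℝ} (hp : ContDiff ℝ ∞ p)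
    (hs : HasCompactSupport p) (m : ℕ) : ∃ C, 0 ≤ C ∧ ∀ k ≤ m, ∀ s, |iteratedDeriv k p s| ≤ C := by
  have h : ∀ k : ℕ, ∃ C, ∀ s, ‖iteratedFDeriv ℝ k p s‖ ≤ C := fun k =>
    (hs.iteratedFDeriv k).exists_bound_of_continuous
      (hp.continuous_iteratedFDeriv (by exact_mod_cast le_top))
  choose C hC using h
  have hC0 : ∀ k, 0 ≤ C k := fun k => (norm_nonneg _).trans (hC k 0)
  refine ⟨∑ k ∈ Finset.range (m + 1), C k, Finset.sum_nonneg fun k _ => hC0 k, fun k hk s => ?_⟩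
  rw [← Real.norm_eq_abs, ← norm_iteratedFDeriv_eq_norm_iteratedDeriv]
  exact (hC k s).trans
    (Finset.single_le_sum (fun k _ => hC0 k) (Finset.mem_range.2 (Nat.lt_succ_of_le hk)))

/-- A smooth function that agrees with `c * t ^ n` near `0` and whose derivatives of order less
than `n` are small. -/
theorem exists_contDiff_eventuallyEq_monomial (c : ℝ) (n : ℕ) {ε : ℝ} (hε : 0 < ε) :
    ∃ u : ℝ → ℝ, ContDiff ℝ ∞ u ∧ (u =ᶠ[𝓝 0] fun t => c * t ^ n) ∧
      ∀ k < n, ∀ t, |iteratedDeriv k u t| ≤ ε := by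
  let χ : ContDiffBump (0 : ℝ) := ⟨1, 2, one_pos, one_lt_two⟩
  have hp : ContDiff ℝ ∞ fun s => s ^ n * χ s := (contDiff_id.pow n).mul χ.contDiff
  have hsupp : HasCompactSupport fun s => s ^ n * χ s := χ.hasCompactSupport.mul_left
  obtain ⟨C, hC0, hC⟩ := exists_bound_iteratedDeriv_of_hasCompactSupport hp hsupp n
  -- Compressing the cutoff by l multiplies the k-th derivative by l^(k-n), at most 1/l for k < n; l
  -- makes the resulting bound |c| C / l at most ε.
  obtain ⟨l, hl1, hl⟩ : ∃ l : ℝ, 1 ≤ l ∧ |c| * C ≤ ε * l := by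
    refine ⟨max 1 (|c| * C / ε), le_max_left _ _, ?_⟩
    calc |c| * C = ε * (|c| * C / ε) := by field_simp
      _ ≤ _ := by gcongr; exact le_max_right _ _
  have hl0 : 0 < l := one_pos.trans_le hl1
  refine ⟨fun t => (c / l ^ n) * ((l * t) ^ n * χ (l * t)), ?_, ?_, ?_⟩
  · exact contDiff_const.mul (hp.comp (contDiff_const.mul contDiff_id))
  · have : Tendsto (fun t : ℝ => l * t) (𝓝 0) (𝓝 0) := by
      have := (continuous_const_mul l).tendsto 0
      rwa [mul_zero] at this
    filter_upwards [this.eventually χ.eventuallyEq_one] with t ht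
    rw [ht, Pi.one_apply, mul_pow]
    field_simp
  · intro k hk t
    have h1 := iteratedDeriv_comp_const_mul (n := k)
      (hp.of_le (by exact_mod_cast le_top)) l
    rw [iteratedDeriv_const_mul_field, h1]
    have h2 := hC k hk.le (l * t)
    have h3 : l ^ k * l ≤ l ^ n := by
      rw [← pow_succ]; exact pow_le_pow_right₀ hl1 hk
    rw [abs_mul, abs_mul, abs_div, abs_of_pos (pow_pos hl0 n), abs_of_pos (pow_pos hl0 k),
      div_mul_eq_mul_div, div_le_iff₀ (pow_pos hl0 n)]
    calc |c| * (l ^ k * |iteratedDeriv k (fun s => s ^ n * χ s) (l * t)|)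
        ≤ |c| * (l ^ k * C) := by gcongr
      _ = l ^ k * (|c| * C) := by ring
      _ ≤ l ^ k * (ε * l) := by gcongr
      _ = ε * (l ^ k * l) := by ring
      _ ≤ ε * l ^ n := by gcongr

/-- Borel's lemma on the line. -/
theorem exists_contDiff_iteratedDeriv_eq (a : ℕ → ℝ) :
    ∃ f : ℝ → ℝ, ContDiff ℝ ∞ f ∧ ∀ n, iteratedDeriv n f 0 = a n := by
  choose u hu hu0 hub using fun n => exists_contDiff_eventuallyEq_monomial
    (a n / (n.factorial : ℝ)) n (ε := (1 / 2) ^ n) (by positivity)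
  have hderiv : ∀ n k, iteratedDeriv k (u n) 0 = if k = n then a n else 0 := by
    intro n k
    rw [(hu0 n).iteratedDeriv_eq k, iteratedDeriv_const_mul_field, iteratedDeriv_fun_pow_zero]
    split_ifs
    · field_simp
    · simp
  have hgeo : Summable fun n : ℕ => (1 / 2 : ℝ) ^ n := summable_geometric_two
  -- Past index m the geometric bound controls all derivatives up to order m, and no term
  -- contributes to the m-th derivative at 0.
  have htail : ∀ m : ℕ, ContDiff ℝ m (fun t => ∑' n, u (n + (m + 1)) t) ∧
      iteratedDeriv m (fun t => ∑' n, u (n + (m + 1)) t) 0 = 0 := by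
    intro m
    have h1 : ∀ n, ContDiff ℝ (m : ℕ∞) (u (n + (m + 1))) := fun n =>
      (hu _).of_le (by exact_mod_cast le_top)
    have h2 : ∀ k : ℕ, (k : ℕ∞) ≤ m → Summable fun n : ℕ => (1 / 2 : ℝ) ^ (n + (m + 1)) :=
      fun _ _ => (summable_nat_add_iff (m + 1)).2 hgeo
    have h3 : ∀ (k n : ℕ) (t : ℝ), (k : ℕ∞) ≤ m →
        ‖iteratedFDeriv ℝ k (u (n + (m + 1))) t‖ ≤ (1 / 2 : ℝ) ^ (n + (m + 1)) := by
      intro k n t hk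
      have hk : k ≤ m := by exact_mod_cast hk
      rw [norm_iteratedFDeriv_eq_norm_iteratedDeriv]
      exact hub _ k (by omega) t
    refine ⟨contDiff_tsum h1 h2 h3, ?_⟩
    rw [iteratedDeriv, iteratedFDeriv_tsum_apply h1 h2 h3 le_rfl]
    have : ∀ n, iteratedFDeriv ℝ m (u (n + (m + 1))) 0 = 0 := by
      intro n
      rw [← norm_eq_zero, norm_iteratedFDeriv_eq_norm_iteratedDeriv, hderiv, if_neg (by omega),
        norm_zero]
    simp [this]
  have hsum : ∀ t, Summable fun n => u n t := by
    intro t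
    refine (summable_nat_add_iff 1).1 (.of_norm_bounded ((summable_nat_add_iff 1).2 hgeo) fun n => ?_)
    simpa using hub (n + 1) 0 (Nat.succ_pos n) t
  have hsplit : ∀ m : ℕ, (fun t => ∑' n, u n t) =
      fun t => (∑ n ∈ Finset.range (m + 1), u n t) + ∑' n, u (n + (m + 1)) t := fun m =>
    funext fun t => ((hsum t).sum_add_tsum_nat_add (m + 1)).symm
  have hfin : ∀ m : ℕ, ContDiff ℝ m fun t => ∑ n ∈ Finset.range (m + 1), u n t := fun m =>
    ContDiff.sum fun n _ => (hu n).of_le (by exact_mod_cast le_top)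
  refine ⟨fun t => ∑' n, u n t, contDiff_infty.2 fun m => ?_, fun m => ?_⟩
  · rw [hsplit m]
    exact (hfin m).add (htail m).1
  · rw [hsplit m, iteratedDeriv_fun_add (hfin m).contDiffAt (htail m).1.contDiffAt, (htail m).2,
      add_zero, iteratedDeriv_fun_sum fun n _ => ((hu n).of_le (by exact_mod_cast le_top)).contDiffAt]
    simp [hderiv]

/-! ### Flat functions and Whitney's theorem on even functions -/

/-- A smooth function on the line that is infinitely flat at `0`. -/
structure IsFlat (F : ℝ → ℝ) : Prop where
  contDiff : ContDiff ℝ ∞ F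
  divisible : ∀ N : ℕ, ∃ R : ℝ → ℝ, ContDiff ℝ ∞ R ∧ ∀ t, F t = t ^ N * R t

namespace IsFlat

variable {F : ℝ → ℝ}

theorem apply_zero (hF : IsFlat F) : F 0 = 0 := by
  obtain ⟨R, -, h⟩ := hF.divisible 1
  simp [h 0]

theorem exists_eq_mul (hF : IsFlat F) : ∃ K, IsFlat K ∧ ∀ t, F t = t * K t := by
  obtain ⟨K, hK, h⟩ := hF.divisible 1
  simp only [pow_one] at h
  refine ⟨K, ⟨hK, fun N => ?_⟩, h⟩
  obtain ⟨R, hR, h'⟩ := hF.divisible (N + 1)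
  refine ⟨R, hR, ?_⟩
  have hKR : Set.EqOn K (fun t => t ^ N * R t) {0}ᶜ := by
    intro t ht
    have : t * K t = t * (t ^ N * R t) := by rw [← h t, h' t]; ring
    exact mul_left_cancel₀ ht this
  have := Continuous.ext_on (dense_compl_singleton (0 : ℝ)) hK.continuous
    ((continuous_pow N).mul hR.continuous) hKR
  exact congr_fun this

theorem deriv (hF : IsFlat F) : IsFlat (deriv F) := by
  refine ⟨(contDiff_infty_iff_deriv.1 hF.contDiff).2, fun N => ?_⟩
  obtain ⟨R, hR, h⟩ := hF.divisible (N + 1)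
  have hR' : ContDiff ℝ ∞ (_root_.deriv R) := (contDiff_infty_iff_deriv.1 hR).2
  refine ⟨fun t => (N + 1) * R t + t * _root_.deriv R t, by fun_prop, fun t => ?_⟩
  have h1 : HasDerivAt (fun t => t ^ (N + 1) * R t) _ t :=
    (hasDerivAt_pow (N + 1) t).mul (hR.differentiable (by simp) t).hasDerivAt
  rw [show F = _ from funext h, h1.deriv]
  push_cast [Nat.add_sub_cancel]
  ring

theorem const_mul (hF : IsFlat F) (c : ℝ) : IsFlat fun t => c * F t := by
  refine ⟨contDiff_const.mul hF.contDiff, fun N => ?_⟩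
  obtain ⟨R, hR, h⟩ := hF.divisible N
  exact ⟨fun t => c * R t, contDiff_const.mul hR, fun t => by rw [h t]; ring⟩

theorem add {G : ℝ → ℝ} (hF : IsFlat F) (hG : IsFlat G) : IsFlat fun t => F t + G t := by
  refine ⟨hF.contDiff.add hG.contDiff, fun N => ?_⟩
  obtain ⟨R, hR, h⟩ := hF.divisible N
  obtain ⟨S, hS, h'⟩ := hG.divisible N
  exact ⟨fun t => R t + S t, hR.add hS, fun t => by rw [h t, h' t]; ring⟩

theorem comp_neg (hF : IsFlat F) : IsFlat fun t => F (-t) := by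
  refine ⟨hF.contDiff.comp contDiff_neg, fun N => ?_⟩
  obtain ⟨R, hR, h⟩ := hF.divisible N
  exact ⟨fun t => (-1) ^ N * R (-t), contDiff_const.mul (hR.comp contDiff_neg), fun t => by
    rw [h (-t), neg_pow]; ring⟩

theorem hasDerivAt_comp_sqrt {K : ℝ → ℝ} (hF : IsFlat F) (hK : IsFlat K)
    (h : ∀ t, _root_.deriv F t = t * K t) (x : ℝ) :
    HasDerivAt (fun x => F (√x)) (1 / 2 * K (√x)) x := by
  rcases lt_trichotomy x 0 with hx | rfl | hx
  -- The real square root is 0 on negative numbers, so the composition is locally constant there.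
  · rw [Real.sqrt_eq_zero_of_nonpos hx.le, hK.apply_zero, mul_zero]
    refine (hasDerivAt_const x (0 : ℝ)).congr_of_eventuallyEq ?_
    filter_upwards [gt_mem_nhds hx] with y hy
    rw [Real.sqrt_eq_zero_of_nonpos hy.le, hF.apply_zero]
  · rw [Real.sqrt_zero, hK.apply_zero, mul_zero]
    -- Divisibility by t^4 gives F(√x) = O(x^2), which is o(x).
    obtain ⟨R, hR, hFR⟩ := hF.divisible 4
    rw [hasDerivAt_iff_isLittleO]
    simp only [Real.sqrt_zero, hF.apply_zero, sub_zero, smul_zero]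
    have hb : (fun x : ℝ => R (√x)) =O[𝓝 0] fun _ => (1 : ℝ) :=
      (hR.continuous.comp Real.continuous_sqrt).continuousAt.isBigO_one ℝ
    have h1 : (fun x : ℝ => √x ^ 4) =O[𝓝 0] fun x => x ^ 2 := by
      refine IsBigO.of_norm_le fun x => ?_
      rcases le_total 0 x with hx | hx
      · rw [show √x ^ 4 = (√x ^ 2) ^ 2 by ring, Real.sq_sqrt hx]
        simp
      · rw [Real.sqrt_eq_zero_of_nonpos hx]
        simpa using sq_nonneg x
    have h2 : (fun x : ℝ => x ^ 2) =o[𝓝 0] fun x => x := by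
      simpa using isLittleO_pow_pow (𝕜 := ℝ) one_lt_two
    have h3 := (h1.mul hb).trans_isLittleO (by simpa using h2)
    exact h3.congr_left fun x => (hFR _).symm
  · have h1 := (Real.hasDerivAt_sqrt hx.ne')
    have h2 := ((hF.contDiff.differentiable (by simp)) (√x)).hasDerivAt
    refine (h2.comp x h1).congr_deriv ?_
    rw [h]
    have : √x ≠ 0 := (Real.sqrt_pos.2 hx).ne'
    field_simp

/-- If F' = t K then F(√x) has derivative K(√x)/2, and K is flat again, so the induction applies to
K. -/
theorem contDiff_comp_sqrt (hF : IsFlat F) : ContDiff ℝ ∞ fun x => F (√x) := by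
  refine contDiff_infty.2 fun n => ?_
  induction n generalizing F with
  | zero => exact contDiff_zero.2 (hF.contDiff.continuous.comp Real.continuous_sqrt)
  | succ n ih =>
    obtain ⟨K, hK, h⟩ := hF.deriv.exists_eq_mul
    have hd := hF.hasDerivAt_comp_sqrt hK h
    have hd' := funext fun x => (hd x).deriv
    push_cast
    refine contDiff_succ_iff_deriv.2 ⟨fun x => (hd x).differentiableAt,
      fun h => absurd h (by simp), ?_⟩
    rw [hd']
    exact contDiff_const.mul (ih hK)

/-- With F = t K, the even part of F and the even part of K depend only on |t| = √(t^2), and the odd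
part of F is t times the even part of K. -/
theorem exists_eq_sq_add_mul_sq (hF : IsFlat F) : ∃ g k : ℝ → ℝ, ContDiff ℝ ∞ g ∧ ContDiff ℝ ∞ k ∧
    ∀ t, F t = g (t ^ 2) + t * k (t ^ 2) := by
  obtain ⟨K, hK, h⟩ := hF.exists_eq_mul
  refine ⟨fun x => 1 / 2 * (F (√x) + F (-√x)), fun x => 1 / 2 * (K (√x) + K (-√x)),
    ((hF.add hF.comp_neg).const_mul _).contDiff_comp_sqrt,
    ((hK.add hK.comp_neg).const_mul _).contDiff_comp_sqrt, fun t => ?_⟩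
  simp only [Real.sqrt_sq_eq_abs]
  rcases abs_cases t with ⟨ht, -⟩ | ⟨ht, -⟩ <;> rw [ht]
  · linear_combination (1 / 2) * h t - (1 / 2) * h (-t)
  · rw [neg_neg]
    linear_combination (1 / 2) * h t - (1 / 2) * h (-t)

end IsFlat

/-- Whitney's theorem: a smooth function on the line splits into its even and odd parts, which are
smooth in the square of the variable. -/
theorem exists_contDiff_eq_sq_add_mul_sq {f : ℝ → ℝ} (hf : ContDiff ℝ ∞ f) :
    ∃ g k : ℝ → ℝ, ContDiff ℝ ∞ g ∧ ContDiff ℝ ∞ k ∧ ∀ t, f t = g (t ^ 2) + t * k (t ^ 2) := by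
  let a : ℕ → ℝ := fun i => iteratedDeriv i f 0 / (i.factorial : ℝ)
  -- Borel's lemma realizes the even and the odd Taylor coefficients of f separately, so that only a
  -- flat difference is left to split.
  obtain ⟨b, hb, hb0⟩ := exists_contDiff_iteratedDeriv_eq fun n => (n.factorial : ℝ) * a (2 * n)
  obtain ⟨d, hd, hd0⟩ := exists_contDiff_iteratedDeriv_eq fun n => (n.factorial : ℝ) * a (2 * n + 1)
  have hfact : ∀ (n : ℕ) (c : ℝ), (n.factorial : ℝ) * c / (n.factorial : ℝ) = c := fun n c => by
    field_simp
  have hF : IsFlat fun t => f t - (b (t ^ 2) + t * d (t ^ 2)) := by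
    refine ⟨by fun_prop, fun N => ?_⟩
    obtain ⟨R, hR, hfR⟩ := exists_taylor_remainder hf (2 * N)
    obtain ⟨S, hS, hbS⟩ := exists_taylor_remainder hb N
    obtain ⟨T, hT, hdT⟩ := exists_taylor_remainder hd N
    refine ⟨fun t => t ^ N * (R t - S (t ^ 2) - t * T (t ^ 2)), by fun_prop, fun t => ?_⟩
    have hsum : ∀ M : ℕ, ∑ i ∈ Finset.range (2 * M), a i * t ^ i =
        ∑ i ∈ Finset.range M, a (2 * i) * (t ^ 2) ^ i +
          t * ∑ i ∈ Finset.range M, a (2 * i + 1) * (t ^ 2) ^ i := by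
      intro M
      induction M with
      | zero => simp
      | succ M ih =>
        rw [show 2 * (M + 1) = 2 * M + 1 + 1 by ring, Finset.sum_range_succ, Finset.sum_range_succ,
          ih, Finset.sum_range_succ, Finset.sum_range_succ]
        ring
    simp only [hb0, hfact] at hbS
    simp only [hd0, hfact] at hdT
    rw [hfR t, hbS (t ^ 2), hdT (t ^ 2), hsum N]
    ring
  obtain ⟨g, k, hg, hk, h⟩ := hF.exists_eq_sq_add_mul_sq
  exact ⟨fun x => g x + b x, fun x => k x + d x, hg.add hb, hk.add hd, fun t => by
    linear_combination h t⟩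

theorem exists_contDiff_eq_sum_pow_four {f : ℝ → ℝ} (hf : ContDiff ℝ ∞ f) :
    ∃ a₀ a₁ a₂ a₃ : ℝ → ℝ, ContDiff ℝ ∞ a₀ ∧ ContDiff ℝ ∞ a₁ ∧ ContDiff ℝ ∞ a₂ ∧ ContDiff ℝ ∞ a₃ ∧
      ∀ t, f t = a₀ (t ^ 4) + t * a₁ (t ^ 4) + t ^ 2 * a₂ (t ^ 4) + t ^ 3 * a₃ (t ^ 4) := by
  obtain ⟨g, k, hg, hk, h⟩ := exists_contDiff_eq_sq_add_mul_sq hf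
  obtain ⟨a₀, a₂, h₀, h₂, hga⟩ := exists_contDiff_eq_sq_add_mul_sq hg
  obtain ⟨a₁, a₃, h₁, h₃, hka⟩ := exists_contDiff_eq_sq_add_mul_sq hk
  refine ⟨a₀, a₁, a₂, a₃, h₀, h₁, h₂, h₃, fun t => ?_⟩
  rw [h t, hga, hka, show (t ^ 2) ^ 2 = t ^ 4 by ring]
  ring

/-! ### Diffeomorphism germs and equivalence of curves -/

section DiffeoGerm

variable {E F G : Type*} [NormedAddCommGroup E] [NormedSpace ℝ E] [NormedAddCommGroup F]
  [NormedSpace ℝ F] [NormedAddCommGroup G] [NormedSpace ℝ G] {r : WithTop ℕ∞}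

theorem IsDiffeoGerm.refl (p : E) : IsDiffeoGerm r (OpenPartialHomeomorph.refl E) p p :=
  ⟨trivial, rfl, contDiffOn_id, contDiffOn_id⟩

theorem IsDiffeoGerm.symm {f : OpenPartialHomeomorph E F} {p : E} {q : F}
    (h : IsDiffeoGerm r f p q) : IsDiffeoGerm r f.symm q p := by
  obtain ⟨hp, rfl, h1, h2⟩ := h
  exact ⟨f.map_source hp, f.left_inv hp, h2, h1⟩

theorem IsDiffeoGerm.trans {f : OpenPartialHomeomorph E F} {g : OpenPartialHomeomorph F G}
    {p : E} {q : F} {w : G} (hf : IsDiffeoGerm r f p q) (hg : IsDiffeoGerm r g q w) :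
    IsDiffeoGerm r (f.trans g) p w := by
  obtain ⟨hp, rfl, h1, h2⟩ := hf
  obtain ⟨hq, rfl, h3, h4⟩ := hg
  refine ⟨⟨hp, hq⟩, rfl, ?_, ?_⟩
  · exact h3.comp (h1.mono fun x hx => hx.1) fun x hx => hx.2
  · exact h2.comp (h4.mono fun x hx => hx.1) fun x hx => hx.2

theorem IsDiffeoGerm.tendsto {f : OpenPartialHomeomorph E F} {p : E} {q : F}
    (h : IsDiffeoGerm r f p q) : Tendsto f (𝓝 p) (𝓝 q) := by
  obtain ⟨hp, rfl, -, -⟩ := h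
  exact f.continuousAt hp

/-- The inverse function theorem, as a statement on diffeomorphism germs. -/
theorem exists_isDiffeoGerm [CompleteSpace E] (hr : 1 ≤ r) {f : E → F} (hf : ContDiff ℝ r f)
    {p : E} {f' : E ≃L[ℝ] F} (hf' : HasFDerivAt f (f' : E →L[ℝ] F) p) :
    ∃ e : OpenPartialHomeomorph E F, (e : E → F) = f ∧ IsDiffeoGerm r e p (f p) := by
  have hr0 : r ≠ 0 := (zero_lt_one.trans_le hr).ne'
  let e₀ := hf.contDiffAt.toOpenPartialHomeomorph f hf' hr0
  -- Restricting to the open set where the derivative is invertible makes the inverse C^r on the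
  -- whole target, not only near f p.
  let S : Set E := fderiv ℝ f ⁻¹' Set.range ((↑) : (E ≃L[ℝ] F) → E →L[ℝ] F)
  have hS : IsOpen S := ContinuousLinearEquiv.isOpen.preimage (hf.continuous_fderiv hr0)
  have hpS : p ∈ S := ⟨f', hf'.fderiv.symm⟩
  have he : ((e₀.restrOpen S hS : OpenPartialHomeomorph E F) : E → F) = f := rfl
  refine ⟨e₀.restrOpen S hS, he, ?_, by rw [he], by rw [he]; exact hf.contDiffOn, ?_⟩
  · rw [OpenPartialHomeomorph.restrOpen_source]
    exact ⟨hf.contDiffAt.mem_toOpenPartialHomeomorph_source hf' hr0, hpS⟩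
  · intro y hy
    have hx := (e₀.restrOpen S hS).map_target hy
    rw [OpenPartialHomeomorph.restrOpen_source] at hx
    obtain ⟨g, hg⟩ := hx.2
    refine (OpenPartialHomeomorph.contDiffAt_symm _ hy (f₀' := g) ?_ ?_).contDiffWithinAt
    · rw [he, hg]
      exact (hf.differentiable hr0 _).hasFDerivAt
    · rw [he]
      exact hf.contDiffAt

end DiffeoGerm

namespace CrEquivAtZero

variable {r : WithTop ℕ∞} {γ₁ γ₂ γ₃ : ℝ → Plane}

theorem refl (γ : ℝ → Plane) : CrEquivAtZero r γ γ :=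
  ⟨_, _, .refl 0, .refl (γ 0), .of_forall fun _ => rfl⟩

theorem symm (h : CrEquivAtZero r γ₁ γ₂) (hγ : ContinuousAt γ₁ 0) : CrEquivAtZero r γ₂ γ₁ := by
  obtain ⟨ψ, Ψ, hψ, hΨ, h⟩ := h
  refine ⟨ψ.symm, Ψ.symm, hψ.symm, hΨ.symm, ?_⟩
  filter_upwards [hψ.tendsto.eventually h, ψ.open_source.mem_nhds hψ.1,
    hγ.eventually (Ψ.open_source.mem_nhds hΨ.1)] with t h1 h2 h3
  rw [ψ.left_inv h2] at h1
  rw [OpenPartialHomeomorph.symm_symm, ← h1, Ψ.left_inv h3]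

theorem trans (h₁ : CrEquivAtZero r γ₁ γ₂) (h₂ : CrEquivAtZero r γ₂ γ₃) :
    CrEquivAtZero r γ₁ γ₃ := by
  obtain ⟨ψ, Ψ, hψ, hΨ, h⟩ := h₁
  obtain ⟨φ, Φ, hφ, hΦ, h'⟩ := h₂
  refine ⟨ψ.trans φ, Ψ.trans Φ, hψ.trans hφ, hΨ.trans hΦ, ?_⟩
  filter_upwards [hφ.symm.tendsto.eventually h, h'] with t h1 h2
  simp only [OpenPartialHomeomorph.coe_trans, OpenPartialHomeomorph.coe_trans_symm,
    Function.comp_apply]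
  rw [h1, h2]

theorem congr_left {γ₁' : ℝ → Plane} (h : CrEquivAtZero r γ₁ γ₂) (hγ : γ₁ =ᶠ[𝓝 0] γ₁') :
    CrEquivAtZero r γ₁' γ₂ := by
  obtain ⟨ψ, Ψ, hψ, hΨ, h⟩ := h
  refine ⟨ψ, Ψ, hψ, hγ.eq_of_nhds ▸ hΨ, ?_⟩
  filter_upwards [hψ.symm.tendsto.eventually hγ, h] with t h1 h2
  rw [← h1, h2]

/-- Two curves are equivalent as soon as they are intertwined by maps with invertible
derivatives. -/
theorem of_maps (hr : 1 ≤ r) {s : ℝ → ℝ} {s' : ℝ} {Φ : Plane → Plane} {Φ' : Plane ≃L[ℝ] Plane}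
    (hs : ContDiff ℝ r s) (hs0 : s 0 = 0) (hs' : HasDerivAt s s' 0) (hs'0 : s' ≠ 0)
    (hΦ : ContDiff ℝ r Φ) (hΦ0 : Φ (γ₁ 0) = γ₂ 0)
    (hΦ' : HasFDerivAt Φ (Φ' : Plane →L[ℝ] Plane) (γ₁ 0))
    (h : ∀ᶠ t in 𝓝 0, Φ (γ₁ t) = γ₂ (s t)) : CrEquivAtZero r γ₁ γ₂ := by
  obtain ⟨ψ, hψs, hψ⟩ := exists_isDiffeoGerm hr hs (hs'.hasFDerivAt_equiv hs'0)
  obtain ⟨Ψ, hΨΦ, hΨ⟩ := exists_isDiffeoGerm hr hΦ hΦ'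
  rw [hs0] at hψ
  rw [hΦ0] at hΨ
  refine ⟨ψ, Ψ, hψ, hΨ, ?_⟩
  filter_upwards [hψ.symm.tendsto.eventually h, ψ.open_target.mem_nhds hψ.symm.1] with t h1 h2
  rw [hΨΦ, h1, ← hψs, ψ.right_inv h2]

/-- Reparametrization does not change the class of a curve. -/
theorem of_reparam (hr : 1 ≤ r) {s : ℝ → ℝ} {s' : ℝ} (hs : ContDiff ℝ r s) (hs0 : s 0 = 0)
    (hs' : HasDerivAt s s' 0) (hs'0 : s' ≠ 0) (h : ∀ᶠ t in 𝓝 0, γ₁ t = γ₂ (s t)) :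
    CrEquivAtZero r γ₁ γ₂ :=
  of_maps hr hs hs0 hs' hs'0 contDiff_id (by simpa [hs0] using h.self_of_nhds)
    (Φ' := .refl ℝ Plane) (hasFDerivAt_id _) h

end CrEquivAtZero

/-! ### Coordinate changes of the plane -/

/-- The linear automorphism of the plane with matrix `!![a, b; c, d]`. -/
noncomputable def planeEquiv (a b c d : ℝ) (h : a * d - b * c ≠ 0) : Plane ≃L[ℝ] Plane :=
  LinearEquiv.toContinuousLinearEquiv
    { toFun := fun p => !₂[a * p 0 + b * p 1, c * p 0 + d * p 1]
      invFun := fun p => !₂[(a * d - b * c)⁻¹ * (d * p 0 - b * p 1),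
        (a * d - b * c)⁻¹ * (a * p 1 - c * p 0)]
      map_add' := fun p q => by
        ext i; fin_cases i <;> simp <;> ring
      map_smul' := fun t p => by
        ext i; fin_cases i <;> simp <;> ring
      left_inv := fun p => by
        have hk := mul_inv_cancel₀ h
        ext i; fin_cases i <;> simp
        · linear_combination p 0 * hk
        · linear_combination p 1 * hk
      right_inv := fun p => by
        have hk := mul_inv_cancel₀ h
        ext i; fin_cases i <;> simp
        · linear_combination p 0 * hk
        · linear_combination p 1 * hk }

theorem planeEquiv_apply {a b c d : ℝ} (h : a * d - b * c ≠ 0) (p : Plane) :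
    planeEquiv a b c d h p = !₂[a * p 0 + b * p 1, c * p 0 + d * p 1] := rfl

theorem contDiff_plane_mk {E : Type*} [NormedAddCommGroup E] [NormedSpace ℝ E] {n : WithTop ℕ∞}
    {f g : E → ℝ} (hf : ContDiff ℝ n f) (hg : ContDiff ℝ n g) :
    ContDiff ℝ n fun x => (!₂[f x, g x] : Plane) :=
  (contDiff_euclidean (𝕜 := ℝ)).2 (Fin.forall_fin_two.2 ⟨by simpa using hf, by simpa using hg⟩)

theorem contDiff_plane_apply {n : WithTop ℕ∞} (i : Fin 2) : ContDiff ℝ n fun p : Plane => p i :=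
  (contDiff_euclidean (𝕜 := ℝ)).1 contDiff_id i

/-- A perturbation with zero derivative keeps the derivative equal to the identity, so the inverse
function theorem applies to the nonlinear coordinate changes below. -/
theorem hasFDerivAt_plane_mk {f g : Plane → ℝ} {p : Plane} (hf : HasFDerivAt f (0 : Plane →L[ℝ] ℝ) p)
    (hg : HasFDerivAt g (0 : Plane →L[ℝ] ℝ) p) :
    HasFDerivAt (fun x : Plane => (!₂[x 0 + f x, x 1 + g x] : Plane))
      (ContinuousLinearEquiv.refl ℝ Plane : Plane →L[ℝ] Plane) p := by
  have h : HasFDerivAt (fun x : Plane => (!₂[f x, g x] : Plane)) (0 : Plane →L[ℝ] Plane) p := by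
    rw [← hasFDerivWithinAt_univ, hasFDerivWithinAt_euclidean]
    simp only [hasFDerivWithinAt_univ]
    refine Fin.forall_fin_two.2 ⟨?_, ?_⟩
    · simpa using hf
    · simpa using hg
  have := (hasFDerivAt_id (𝕜 := ℝ) p).add h
  rw [add_zero] at this
  refine this.congr_of_eventuallyEq (.of_forall fun x => ?_)
  ext i; fin_cases i <;> simp

theorem hasFDerivAt_mul_of_eq_zero {E : Type*} [NormedAddCommGroup E] [NormedSpace ℝ E]
    {f g : E → ℝ} {p : E} (hf : DifferentiableAt ℝ f p) (hg : DifferentiableAt ℝ g p)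
    (hf0 : f p = 0) (hg0 : g p = 0) : HasFDerivAt (fun x => f x * g x) (0 : E →L[ℝ] ℝ) p := by
  have := hf.hasFDerivAt.mul hg.hasFDerivAt
  rwa [hf0, hg0, zero_smul, zero_smul, add_zero] at this

/-- The curve `t ↦ (t⁴, t⁵ + c t⁷)`. -/
noncomputable def cuspFamily (c t : ℝ) : Plane := !₂[t ^ 4, t ^ 5 + c * t ^ 7]

theorem contDiff_cuspFamily (c : ℝ) {n : WithTop ℕ∞} : ContDiff ℝ n (cuspFamily c) :=
  contDiff_plane_mk (by fun_prop) (by fun_prop)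

/-! ### Reduction to the normal forms -/

theorem exists_contDiff_mul_eq_one {D : ℝ → ℝ} (hD : ContDiff ℝ ∞ D) (h0 : D 0 ≠ 0) :
    ∃ J : ℝ → ℝ, ContDiff ℝ ∞ J ∧ ∀ᶠ t in 𝓝 0, J t * D t = 1 := by
  have hev : ∀ᶠ t in 𝓝 0, D t ≠ 0 := hD.continuous.continuousAt.eventually_ne h0
  obtain ⟨J, hJ, hJD⟩ := exists_contDiff_eventuallyEq (n := ⊤) (f := fun t => (D t)⁻¹) hev
    fun t ht => (hD.contDiffAt.inv ht).contDiffWithinAt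
  refine ⟨J, hJ, ?_⟩
  filter_upwards [hJD, hev] with t h1 h2
  rw [h1, inv_mul_cancel₀ h2]

theorem exists_contDiff_pow_four_eq {W : ℝ → ℝ} (hW : ContDiff ℝ ∞ W) (h0 : W 0 = 1) :
    ∃ V : ℝ → ℝ, ContDiff ℝ ∞ V ∧ V 0 = 1 ∧ ∀ᶠ t in 𝓝 0, V t ^ 4 = W t := by
  have hev : ∀ᶠ t in 𝓝 0, 0 < W t :=
    hW.continuous.continuousAt.eventually (lt_mem_nhds (by rw [h0]; exact one_pos))
  obtain ⟨V, hV, hVW⟩ := exists_contDiff_eventuallyEq (n := ⊤)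
    (f := fun t => W t ^ (1 / 4 : ℝ)) hev
    fun t (ht : 0 < W t) => (hW.contDiffAt.rpow_const_of_ne ht.ne').contDiffWithinAt
  refine ⟨V, hV, ?_, ?_⟩
  · rw [hVW.eq_of_nhds, h0, Real.one_rpow]
  · filter_upwards [hVW, hev] with t h1 h2
    rw [h1, ← Real.rpow_natCast, ← Real.rpow_mul h2.le]
    norm_num

/-- With P = m t^j / 4, the difference V - (1 + P) is V^4 - (1 + P)^4 divided by a factor D with
D(0) = 4, and the numerator is divisible by t^(j+1). -/
theorem exists_fourth_root_remainder {V R : ℝ → ℝ} {m : ℝ} {j : ℕ} (hV : ContDiff ℝ ∞ V)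
    (hR : ContDiff ℝ ∞ R) (hV0 : V 0 = 1) (hj : j ≠ 0)
    (h : ∀ᶠ t in 𝓝 0, V t ^ 4 = 1 + m * t ^ j + t ^ (j + 1) * R t) :
    ∃ v : ℝ → ℝ, ContDiff ℝ ∞ v ∧ ∀ᶠ t in 𝓝 0, V t = 1 + m / 4 * t ^ j + t ^ (j + 1) * v t := by
  obtain ⟨j, rfl⟩ : ∃ k, j = k + 1 := Nat.exists_eq_succ_of_ne_zero hj
  let P : ℝ → ℝ := fun t => m / 4 * t ^ (j + 1)
  let D : ℝ → ℝ := fun t => (V t + (1 + P t)) * (V t ^ 2 + (1 + P t) ^ 2)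
  have hP : ContDiff ℝ ∞ P := by fun_prop
  have hD0 : D 0 ≠ 0 := by simp [D, P, hV0]
  obtain ⟨J, hJ, hJD⟩ := exists_contDiff_mul_eq_one (D := D) (by fun_prop) hD0
  refine ⟨fun t => J t * (R t - t ^ j * (m / 4) ^ 2 * (6 + 4 * P t + P t ^ 2)), by fun_prop, ?_⟩
  filter_upwards [h, hJD] with t h1 h2
  have h3 : (V t - (1 + P t)) * D t =
      t ^ (j + 1 + 1) * (R t - t ^ j * (m / 4) ^ 2 * (6 + 4 * P t + P t ^ 2)) := by
    have : (V t - (1 + P t)) * D t = V t ^ 4 - (1 + P t) ^ 4 := by simp only [D]; ring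
    rw [this, h1]
    simp only [P]
    ring
  linear_combination J t * h3 - (V t - (1 + P t)) * h2

/-- The inverse is recorded as u τ(u), so that a factor t^N becomes u^N times a smooth function of
u. -/
theorem exists_contDiff_localInverse {s : ℝ → ℝ} {s' : ℝ} (hs : ContDiff ℝ ∞ s) (hs0 : s 0 = 0)
    (hs' : HasDerivAt s s' 0) (hs'0 : s' ≠ 0) :
    ∃ τ : ℝ → ℝ, ContDiff ℝ ∞ τ ∧ ∀ᶠ t in 𝓝 0, s t * τ (s t) = t := by
  obtain ⟨e, hes, he0, he, -, he'⟩ := exists_isDiffeoGerm (r := ∞) (by exact_mod_cast le_top) hs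
    (hs'.hasFDerivAt_equiv hs'0)
  rw [hs0] at he
  have h0 : (0 : ℝ) ∈ e.target := he ▸ e.map_source he0
  obtain ⟨σ, hσ, hσe⟩ := exists_contDiff_eventuallyEq (n := ⊤) (e.open_target.mem_nhds h0) he'
  obtain ⟨τ, hτ, hστ⟩ := exists_contDiff_eq_add_mul hσ
  have hσ0 : σ 0 = 0 := by
    have := e.left_inv he0
    rw [he] at this
    rw [hσe.eq_of_nhds, this]
  have hst : Tendsto s (𝓝 0) (𝓝 0) := by simpa only [hs0] using hs.continuous.tendsto 0
  refine ⟨τ, hτ, ?_⟩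
  filter_upwards [hst.eventually hσe, e.open_source.mem_nhds he0] with t h1 h2
  rw [← hes, e.left_inv h2, hes, hστ, hσ0, zero_add] at h1
  exact h1

/-- The parameter of a curve whose first component is a perturbation of `t⁴` can be chosen so that
the first component becomes exactly `t⁴`. -/
theorem exists_aEquivAtZero_of_pow_four_mul {V Y G : ℝ → ℝ} {c : ℝ} {N : ℕ} (hV : ContDiff ℝ ∞ V)
    (hG : ContDiff ℝ ∞ G) (hV0 : V 0 = 1) {X : ℝ → ℝ}
    (hX : ∀ᶠ t in 𝓝 0, X t = t ^ 4 * V t ^ 4)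
    (hY : ∀ᶠ t in 𝓝 0, Y t = (t * V t) ^ 5 + c * (t * V t) ^ 7 + t ^ N * G t) :
    ∃ K : ℝ → ℝ, ContDiff ℝ ∞ K ∧ AEquivAtZero (fun t => !₂[X t, Y t])
      (fun t => !₂[t ^ 4, t ^ 5 + c * t ^ 7 + t ^ N * K t]) := by
  have hs : ContDiff ℝ ∞ fun t => t * V t := by fun_prop
  have hs' : HasDerivAt (fun t => t * V t) 1 0 := by
    have := (hasDerivAt_id (0 : ℝ)).mul (hV.differentiable (by simp) 0).hasDerivAt
    exact this.congr_deriv (by simp [hV0])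
  obtain ⟨τ, hτ, hsτ⟩ := exists_contDiff_localInverse hs (by simp) hs' one_ne_zero
  refine ⟨fun u => τ u ^ N * G (u * τ u), by fun_prop,
    CrEquivAtZero.of_reparam (by exact_mod_cast le_top) hs (by simp) hs' one_ne_zero ?_⟩
  filter_upwards [hX, hY, hsτ] with t h1 h2 h3
  rw [h1, h2, h3, ← mul_assoc ((t * V t) ^ N), ← mul_pow (t * V t) (τ _), h3, mul_pow t _ 4]

/-- The orders 12, 13, 14, 15 cover all residues modulo 4 and are those of x^3, x^2 y, x y^2, y^3.
Combinations of these with coefficients smooth in x = t^4 therefore produce every t^12 K(t). -/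
theorem aEquivAtZero_cuspFamily_of_pow_twelve {K : ℝ → ℝ} (hK : ContDiff ℝ ∞ K) (c : ℝ) :
    AEquivAtZero (fun t => !₂[t ^ 4, t ^ 5 + c * t ^ 7 + t ^ 12 * K t]) (cuspFamily c) := by
  obtain ⟨a₀, a₁, a₂, a₃, h₀, h₁, h₂, h₃, hKa⟩ := exists_contDiff_eq_sum_pow_four hK
  obtain ⟨I, hI, hI1⟩ := exists_contDiff_mul_eq_one (D := fun x => 1 + c ^ 2 * x)
    (by fun_prop) (by simp)
  obtain ⟨J, hJ, hJ1⟩ := exists_contDiff_mul_eq_one (D := fun x => 1 - c ^ 4 * x ^ 2)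
    (by fun_prop) (by simp)
  -- Comparing residues modulo 4 gives two 2×2 systems, for (b₀, b₂) and (b₁, b₃), with determinants
  -- 1 + c^2 x and 1 - c^4 x^2, both equal to 1 at x = 0.
  let b₂ : ℝ → ℝ := fun x => I x * a₂ x
  let b₀ : ℝ → ℝ := fun x => a₀ x - 2 * c * x * b₂ x
  let b₃ : ℝ → ℝ := fun x => J x * (a₃ x - c * a₁ x)
  let b₁ : ℝ → ℝ := fun x => a₁ x - b₃ x * (3 * c * x + c ^ 3 * x ^ 2)
  have hb₂ : ContDiff ℝ ∞ b₂ := by fun_prop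
  have hb₀ : ContDiff ℝ ∞ b₀ := by fun_prop
  have hb₃ : ContDiff ℝ ∞ b₃ := by fun_prop
  have hb₁ : ContDiff ℝ ∞ b₁ := by fun_prop
  have hx : ContDiff ℝ ∞ fun p : Plane => p 0 := contDiff_plane_apply 0
  have hy : ContDiff ℝ ∞ fun p : Plane => p 1 := contDiff_plane_apply 1
  have hu : ContDiff ℝ ∞ fun p : Plane =>
    b₀ (p 0) * p 0 ^ 2 + b₁ (p 0) * p 0 * p 1 + b₂ (p 0) * p 1 ^ 2 := by fun_prop
  have hw : ContDiff ℝ ∞ fun p : Plane => b₃ (p 0) * p 1 ^ 2 := by fun_prop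
  let H : Plane → ℝ := fun p =>
    p 0 * (b₀ (p 0) * p 0 ^ 2 + b₁ (p 0) * p 0 * p 1 + b₂ (p 0) * p 1 ^ 2) +
      p 1 * (b₃ (p 0) * p 1 ^ 2)
  have hH : ContDiff ℝ ∞ H := (hx.mul hu).add (hy.mul hw)
  have hH' : HasFDerivAt H (0 : Plane →L[ℝ] ℝ) 0 := by
    have h1 := hasFDerivAt_mul_of_eq_zero (p := 0) (hx.differentiable (by simp) 0)
      (hu.differentiable (by simp) 0) (by simp) (by simp)
    have h2 := hasFDerivAt_mul_of_eq_zero (p := 0) (hy.differentiable (by simp) 0)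
      (hw.differentiable (by simp) 0) (by simp) (by simp)
    exact (h1.add h2).congr_fderiv (add_zero _)
  refine CrEquivAtZero.symm (γ₁ := cuspFamily c) ?_ (contDiff_cuspFamily c (n := 0)).continuous.continuousAt
  have hz : cuspFamily c 0 = 0 := by ext i; fin_cases i <;> simp [cuspFamily]
  refine CrEquivAtZero.of_maps (by exact_mod_cast le_top) contDiff_id rfl (hasDerivAt_id 0)
    one_ne_zero (Φ := fun p => !₂[p 0 + 0, p 1 + H p]) (Φ' := .refl ℝ Plane)
    (contDiff_plane_mk (by fun_prop) (by fun_prop)) ?_ ?_ ?_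
  · rw [hz]; ext i; fin_cases i <;> simp [H]
  · rw [hz]
    exact hasFDerivAt_plane_mk (hasFDerivAt_const _ _) hH'
  · have ht : Tendsto (fun t : ℝ => t ^ 4) (𝓝 0) (𝓝 0) := by
      simpa using (continuous_pow 4).tendsto (0 : ℝ)
    filter_upwards [ht.eventually hI1, ht.eventually hJ1] with t h1 h2
    ext i; fin_cases i
    · simp [cuspFamily]
    · simp only [cuspFamily, H, b₀, b₁, b₂, b₃, hKa t, id]
      simp
      linear_combination (t ^ 14 * a₂ (t ^ 4)) * h1 + (t ^ 15 * (a₃ (t ^ 4) - c * a₁ (t ^ 4))) * h2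

theorem aEquivAtZero_cuspFamily_of_pow_eight {K : ℝ → ℝ} (hK : ContDiff ℝ ∞ K) (c : ℝ) :
    AEquivAtZero (fun t => !₂[t ^ 4, t ^ 5 + c * t ^ 7 + t ^ 8 * K t]) (cuspFamily c) := by
  obtain ⟨L, hL, hKL⟩ := exists_taylor_remainder hK 4
  obtain ⟨e₀, e₁, e₂, e₃, hKL⟩ : ∃ e₀ e₁ e₂ e₃ : ℝ, ∀ t,
      K t = e₀ + e₁ * t + e₂ * t ^ 2 + e₃ * t ^ 3 + t ^ 4 * L t :=
    ⟨_, _, _, _, fun t => by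
      rw [hKL t, Finset.sum_range_succ, Finset.sum_range_succ, Finset.sum_range_succ,
        Finset.sum_range_one, pow_zero, mul_one, pow_one]⟩
  -- Removing e₁ x y changes the t^11 coefficient to e₃ - c e₁. Adding m y^2 to x forces the
  -- parameter t (1 + (m/4) t^6 + ...), whose fifth power contains (5/4) m t^11; m makes the two
  -- agree.
  obtain ⟨m, hm⟩ : ∃ m : ℝ, m = 4 / 5 * (e₃ - c * e₁) := ⟨_, rfl⟩
  let U : ℝ → ℝ := fun t => c + t * K t
  have hU : ContDiff ℝ ∞ U := by fun_prop
  obtain ⟨V, hV, hV0, hVW⟩ := exists_contDiff_pow_four_eq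
    (W := fun t => 1 + m * t ^ 6 * (1 + t ^ 2 * U t) ^ 2) (by fun_prop) (by simp)
  obtain ⟨v, hv, hVv⟩ := exists_fourth_root_remainder (m := m) (j := 6)
    (R := fun t => m * (2 + t ^ 2 * U t) * U t * t) hV (by fun_prop) hV0 (by norm_num)
    (by filter_upwards [hVW] with t ht; rw [ht]; ring)
  let z : ℝ → ℝ := fun t => m / 4 + t * v t
  have hz : ContDiff ℝ ∞ z := by fun_prop
  have hx : ContDiff ℝ ∞ fun p : Plane => p 0 := contDiff_plane_apply 0
  have hy : ContDiff ℝ ∞ fun p : Plane => p 1 := contDiff_plane_apply 1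
  let w : ℝ → ℝ := fun t => t ^ 6 * z t
  have hw : ContDiff ℝ ∞ w := by fun_prop
  let G : ℝ → ℝ := fun t => L t - e₁ * K t - e₂ * (U t * (2 + t ^ 2 * U t)) - 5 * v t -
    t ^ 5 * z t ^ 2 * (10 + 10 * w t + 5 * w t ^ 2 + w t ^ 3) -
    c * (t * z t * (7 + 21 * w t + 35 * w t ^ 2 + 35 * w t ^ 3 + 21 * w t ^ 4 + 7 * w t ^ 5 +
      w t ^ 6))
  let y : ℝ → ℝ := fun t => t ^ 5 + c * t ^ 7 + t ^ 8 * K t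
  obtain ⟨M, hM, hequiv⟩ := exists_aEquivAtZero_of_pow_four_mul (c := c) (N := 12) (V := V)
    (G := G) (X := fun t => t ^ 4 + m * y t ^ 2)
    (Y := fun t => y t - (e₀ * t ^ 4 * t ^ 4 + e₁ * t ^ 4 * y t + e₂ * y t * y t)) hV
    (by fun_prop) hV0 (by filter_upwards [hVW] with t ht; rw [ht]; simp only [y, U]; ring) (by
      filter_upwards [hVv] with t ht
      have ht' : V t = 1 + w t := by rw [ht]; simp only [w, z]; ring
      have h5 : V t ^ 5 = 1 + 5 * w t + w t ^ 2 * (10 + 10 * w t + 5 * w t ^ 2 + w t ^ 3) := by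
        rw [ht']; ring
      have h7 : V t ^ 7 = 1 + w t * (7 + 21 * w t + 35 * w t ^ 2 + 35 * w t ^ 3 + 21 * w t ^ 4 +
          7 * w t ^ 5 + w t ^ 6) := by
        rw [ht']; ring
      rw [mul_pow, mul_pow, h5, h7]
      simp only [G]
      generalize hB : 10 + 10 * w t + 5 * w t ^ 2 + w t ^ 3 = B₅
      generalize hC : 7 + 21 * w t + 35 * w t ^ 2 + 35 * w t ^ 3 + 21 * w t ^ 4 +
          7 * w t ^ 5 + w t ^ 6 = B₇
      simp only [w, z, U, y]
      linear_combination (t ^ 8) * hKL t - 5 / 4 * t ^ 11 * hm)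
  refine CrEquivAtZero.trans ?_ (CrEquivAtZero.trans hequiv
    (aEquivAtZero_cuspFamily_of_pow_twelve hM c))
  have hzero : (!₂[(0 : ℝ) ^ 4, 0 ^ 5 + c * 0 ^ 7 + 0 ^ 8 * K 0] : Plane) = 0 := by
    ext i; fin_cases i <;> simp
  have hd0 : DifferentiableAt ℝ (fun p : Plane => p 0) 0 := hx.differentiable (by simp) 0
  have hd1 : DifferentiableAt ℝ (fun p : Plane => p 1) 0 := hy.differentiable (by simp) 0
  refine CrEquivAtZero.of_maps (by exact_mod_cast le_top) contDiff_id rfl (hasDerivAt_id 0)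
    one_ne_zero
    (Φ := fun p => !₂[p 0 + m * p 1 * p 1,
      p 1 + (-((e₀ * p 0 * p 0 + e₁ * p 0 * p 1) + e₂ * p 1 * p 1))])
    (Φ' := .refl ℝ Plane) (contDiff_plane_mk (by fun_prop) (by fun_prop)) ?_ ?_ ?_
  · beta_reduce
    rw [hzero]
    ext i; fin_cases i <;> simp [y]
  · beta_reduce
    rw [hzero]
    refine hasFDerivAt_plane_mk (hasFDerivAt_mul_of_eq_zero (hd1.const_mul m) hd1 (by simp)
      (by simp)) ?_
    have h1 := hasFDerivAt_mul_of_eq_zero (hd0.const_mul e₀) hd0 (by simp) (by simp)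
    have h2 := hasFDerivAt_mul_of_eq_zero (hd0.const_mul e₁) hd1 (by simp) (by simp)
    have h3 := hasFDerivAt_mul_of_eq_zero (hd1.const_mul e₂) hd1 (by simp) (by simp)
    exact ((h1.add h2).add h3).neg.congr_fderiv (by simp)
  · refine .of_forall fun t => ?_
    ext i; fin_cases i
    · simp [y]; ring
    · simp [y]; ring

theorem exists_aEquivAtZero_cuspFamily_of_pow_seven {K : ℝ → ℝ} (hK : ContDiff ℝ ∞ K) :
    ∃ c : ℝ, (c = 0 ∨ c = 1 ∨ c = -1) ∧
      AEquivAtZero (fun t => !₂[t ^ 4, t ^ 5 + t ^ 7 * K t]) (cuspFamily c) := by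
  obtain ⟨k, hk, hKk⟩ := exists_contDiff_eq_add_mul hK
  by_cases hK0 : K 0 = 0
  · refine ⟨0, .inl rfl, ?_⟩
    have h := aEquivAtZero_cuspFamily_of_pow_eight hk 0
    have he : ∀ t, t ^ 7 * K t = 0 * t ^ 7 + t ^ 8 * k t := fun t => by rw [hKk t, hK0]; ring
    simp only [he, ← add_assoc]
    exact h
  -- Scaling t by l and (x, y) by (l^4, l^5) divides the t^7 coefficient by l^2.
  · obtain ⟨l, hl, hl2⟩ : ∃ l : ℝ, 0 < l ∧ l ^ 2 = |K 0| :=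
      ⟨√|K 0|, Real.sqrt_pos.2 (abs_pos.2 hK0), Real.sq_sqrt (abs_nonneg _)⟩
    have hl0 := hl.ne'
    refine ⟨K 0 / l ^ 2, .inr ?_, ?_⟩
    · rw [hl2]
      rcases lt_or_gt_of_ne hK0 with h | h
      · right; rw [abs_of_neg h]; field_simp
      · left; rw [abs_of_pos h]; field_simp
    · have h := aEquivAtZero_cuspFamily_of_pow_eight
        (K := fun s => k (l⁻¹ * s) / l ^ 3) (by fun_prop) (K 0 / l ^ 2)
      refine CrEquivAtZero.trans ?_ h
      refine CrEquivAtZero.of_maps (by exact_mod_cast le_top) (s := fun t => l * t) (s' := l)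
        (by fun_prop) (by simp) (by simpa using (hasDerivAt_id (0 : ℝ)).const_mul l) hl0
        (Φ' := planeEquiv (l ^ 4) 0 0 (l ^ 5) (by simp [hl0]))
        (ContinuousLinearEquiv.contDiff _) ?_ (ContinuousLinearEquiv.hasFDerivAt _) ?_
      · ext i; fin_cases i <;> simp [planeEquiv_apply]
      · refine .of_forall fun t => ?_
        ext i; fin_cases i
        · simp [planeEquiv_apply]; ring
        · simp [planeEquiv_apply, hKk t]
          rw [inv_mul_cancel_left₀ hl0]
          field_simp
          ring

theorem ContDiff.plane_coord {γ : ℝ → Plane} {n : WithTop ℕ∞} (hγ : ContDiff ℝ n γ) (i : Fin 2) :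
    ContDiff ℝ n fun t => γ t i :=
  (contDiff_plane_apply i).comp hγ

theorem iteratedDeriv_plane_coord {γ : ℝ → Plane} (hγ : ContDiff ℝ ∞ γ) (n : ℕ) (t : ℝ)
    (i : Fin 2) : iteratedDeriv n γ t i = iteratedDeriv n (fun t => γ t i) t := by
  induction n generalizing γ with
  | zero => rfl
  | succ n ih =>
    have hd : deriv (fun t => γ t i) = fun t => deriv γ t i := funext fun t =>
      ((EuclideanSpace.proj (𝕜 := ℝ) i).hasFDerivAt.comp_hasDerivAt t
        (hγ.differentiable (by simp) t).hasDerivAt).deriv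
    rw [iteratedDeriv_succ', iteratedDeriv_succ', ih (contDiff_infty_iff_deriv.1 hγ).2, hd]

theorem jetDet_eq (γ : ℝ → Plane) (i j : ℕ) :
    jetDet γ i j = iteratedDeriv i γ 0 0 * iteratedDeriv j γ 0 1 -
      iteratedDeriv j γ 0 0 * iteratedDeriv i γ 0 1 := by
  simp [jetDet, planeDet, Matrix.det_fin_two]

theorem IsFourFiveJet.exists_aEquivAtZero_cuspFamily {γ : ℝ → Plane} (hγ : ContDiff ℝ ∞ γ)
    (h : IsFourFiveJet γ) :
    ∃ c : ℝ, (c = 0 ∨ c = 1 ∨ c = -1) ∧ AEquivAtZero γ (cuspFamily c) := by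
  obtain ⟨h1, h2, h3, hA⟩ := h
  have hcoord : ∀ i : Fin 2, ∃ R : ℝ → ℝ, ContDiff ℝ ∞ R ∧ ∀ t, γ t i = γ 0 i +
      iteratedDeriv 4 γ 0 i / 24 * t ^ 4 + iteratedDeriv 5 γ 0 i / 120 * t ^ 5 +
      iteratedDeriv 6 γ 0 i / 720 * t ^ 6 + t ^ 7 * R t := by
    intro i
    obtain ⟨R, hR, h⟩ := exists_taylor_remainder (hγ.plane_coord i) 7
    refine ⟨R, hR, fun t => ?_⟩
    rw [h t]
    simp only [← iteratedDeriv_plane_coord hγ]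
    simp [Finset.sum_range_succ, h1, h2, h3, Nat.factorial]
  obtain ⟨R₀, hR₀, hx⟩ := hcoord 0
  obtain ⟨R₁, hR₁, hy⟩ := hcoord 1
  rw [cuspA, jetDet_eq] at hA
  generalize iteratedDeriv 4 γ 0 0 = a₄ at *
  generalize iteratedDeriv 5 γ 0 0 = a₅ at *
  generalize iteratedDeriv 6 γ 0 0 = a₆ at *
  generalize iteratedDeriv 4 γ 0 1 = b₄ at *
  generalize iteratedDeriv 5 γ 0 1 = b₅ at *
  generalize iteratedDeriv 6 γ 0 1 = b₆ at *
  obtain ⟨J, hJ⟩ : ∃ J, J * (a₅ * b₄ - a₄ * b₅) = 1 := ⟨_, inv_mul_cancel₀ hA⟩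
  obtain ⟨q, hq⟩ : ∃ q, q = (a₆ * b₄ - a₄ * b₆) * J / 6 := ⟨_, rfl⟩
  -- the linear map sends the fourth derivative to the first axis and removes the sixth order term
  obtain ⟨c, hc⟩ : ∃ c, c = 120 * b₄ * J := ⟨_, rfl⟩
  obtain ⟨d, hd⟩ : ∃ d, d = -(120 * a₄ * J) := ⟨_, rfl⟩
  -- The multiple (4/5) q of the second row makes the first component t^4 (1 + (4/5) q t + ...). The
  -- new parameter is then t + (q/5) t^2 + ..., and its fifth power absorbs the term q t^6.
  obtain ⟨a, ha⟩ : ∃ a, a = -(24 * b₅ * J) + 4 / 5 * q * c := ⟨_, rfl⟩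
  obtain ⟨b, hb⟩ : ∃ b, b = 24 * a₅ * J + 4 / 5 * q * d := ⟨_, rfl⟩
  have hdet : a * d - b * c ≠ 0 := by
    have hJ0 : J ≠ 0 := left_ne_zero_of_mul_eq_one hJ
    have : a * d - b * c = -2880 * J := by
      rw [ha, hb, hc, hd]; linear_combination (-2880 * J) * hJ
    rw [this]
    exact mul_ne_zero (by norm_num) hJ0
  have hX4 : a * a₄ + b * b₄ = 24 := by
    rw [ha, hb, hc, hd]; linear_combination 24 * hJ
  have hX5 : a * a₅ + b * b₅ = 120 * (4 / 5 * q) := by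
    rw [ha, hb, hc, hd]; linear_combination 120 * (4 / 5 * q) * hJ
  have hY4 : c * a₄ + d * b₄ = 0 := by
    rw [hc, hd]; ring
  have hY5 : c * a₅ + d * b₅ = 120 := by
    rw [hc, hd]; linear_combination 120 * hJ
  have hY6 : c * a₆ + d * b₆ = 720 * q := by
    rw [hc, hd, hq]; ring
  let S : ℝ → ℝ := fun t => (a * a₆ + b * b₆) / 720 + t * (a * R₀ t + b * R₁ t)
  have hS : ContDiff ℝ ∞ S := by fun_prop
  obtain ⟨V, hV, hV0, hVW⟩ := exists_contDiff_pow_four_eq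
    (W := fun t => 1 + 4 / 5 * q * t + t ^ 2 * S t) (by fun_prop) (by simp)
  obtain ⟨v, hv, hVv⟩ := exists_fourth_root_remainder (m := 4 / 5 * q) (j := 1)
    (R := S) hV hS hV0 one_ne_zero (by filter_upwards [hVW] with t ht; rw [ht]; ring)
  let z : ℝ → ℝ := fun t => q / 5 + t * v t
  let w : ℝ → ℝ := fun t => t * z t
  let X : ℝ → ℝ := fun t => a * (γ t 0 - γ 0 0) + b * (γ t 1 - γ 0 1)
  let Y : ℝ → ℝ := fun t => c * (γ t 0 - γ 0 0) + d * (γ t 1 - γ 0 1)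
  obtain ⟨K, hK, hequiv⟩ := exists_aEquivAtZero_of_pow_four_mul (c := 0) (N := 7) (V := V)
    (X := X) (Y := Y) (G := fun t => c * R₀ t + d * R₁ t - 5 * v t -
      z t ^ 2 * (10 + 10 * w t + 5 * w t ^ 2 + w t ^ 3)) hV (by fun_prop) hV0
    (by
      filter_upwards [hVW] with t ht
      rw [ht]
      simp only [X, S, hx t, hy t]
      linear_combination t ^ 4 / 24 * hX4 + t ^ 5 / 120 * hX5)
    (by
      filter_upwards [hVv] with t ht
      have ht' : V t = 1 + w t := by rw [ht]; simp only [w, z]; ring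
      have h5 : V t ^ 5 = 1 + 5 * w t + w t ^ 2 * (10 + 10 * w t + 5 * w t ^ 2 + w t ^ 3) := by
        rw [ht']; ring
      rw [mul_pow, h5]
      generalize hB : 10 + 10 * w t + 5 * w t ^ 2 + w t ^ 3 = B
      simp only [Y, w, z, hx t, hy t]
      linear_combination t ^ 4 / 24 * hY4 + t ^ 5 / 120 * hY5 + t ^ 6 / 720 * hY6)
  obtain ⟨e, he, hKe⟩ := exists_aEquivAtZero_cuspFamily_of_pow_seven hK
  refine ⟨e, he, CrEquivAtZero.trans ?_ (CrEquivAtZero.trans hequiv ?_)⟩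
  · refine CrEquivAtZero.of_maps (by exact_mod_cast le_top) contDiff_id rfl (hasDerivAt_id 0)
      one_ne_zero (Φ := fun p => planeEquiv a b c d hdet (p - γ 0))
      (Φ' := planeEquiv a b c d hdet)
      ((ContinuousLinearEquiv.contDiff _).comp (contDiff_id.sub contDiff_const)) ?_ ?_ ?_
    · ext i; fin_cases i <;> simp [planeEquiv_apply, X, Y]
    · exact ((planeEquiv a b c d hdet).hasFDerivAt.comp _
        ((hasFDerivAt_id _).sub_const _)).congr_fderiv (by ext; simp)
    · refine .of_forall fun t => ?_
      ext i; fin_cases i <;> simp [planeEquiv_apply, X, Y]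
  · simp only [zero_mul, add_zero]
    exact hKe

/-! ### The 7-jet of an equivalent curve and the sign of its curvature -/

/-- `f` agrees with the cubic `a₀ + a₁ t + a₂ t² + a₃ t³` up to fourth order at `0`. -/
def HasCubicJet (f : ℝ → ℝ) (a₀ a₁ a₂ a₃ : ℝ) : Prop :=
  ∃ R : ℝ → ℝ, Continuous R ∧ ∀ t, f t = a₀ + a₁ * t + a₂ * t ^ 2 + a₃ * t ^ 3 + t ^ 4 * R t

theorem HasCubicJet.mul {f g : ℝ → ℝ} {a₀ a₁ a₂ a₃ b₀ b₁ b₂ b₃ : ℝ}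
    (hf : HasCubicJet f a₀ a₁ a₂ a₃) (hg : HasCubicJet g b₀ b₁ b₂ b₃) :
    HasCubicJet (fun t => f t * g t) (a₀ * b₀) (a₀ * b₁ + a₁ * b₀) (a₀ * b₂ + a₁ * b₁ + a₂ * b₀)
      (a₀ * b₃ + a₁ * b₂ + a₂ * b₁ + a₃ * b₀) := by
  obtain ⟨R, hR, hf⟩ := hf
  obtain ⟨S, hS, hg⟩ := hg
  refine ⟨fun t => a₁ * b₃ + a₂ * b₂ + a₃ * b₁ + (a₂ * b₃ + a₃ * b₂) * t + a₃ * b₃ * t ^ 2 +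
    R t * (b₀ + b₁ * t + b₂ * t ^ 2 + b₃ * t ^ 3) +
    S t * (a₀ + a₁ * t + a₂ * t ^ 2 + a₃ * t ^ 3) + t ^ 4 * (R t * S t), by fun_prop, fun t => ?_⟩
  simp only [hf t, hg t]
  ring

theorem iteratedDeriv_eq_of_isBigO {f : ℝ → ℝ} (hf : ContDiff ℝ ∞ f) {N : ℕ} {c : ℕ → ℝ}
    (h : (fun t => f t - ∑ i ∈ Finset.range N, c i * t ^ i) =O[𝓝 0] fun t => t ^ N) {i : ℕ}
    (hi : i < N) : iteratedDeriv i f 0 = i.factorial * c i := by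
  obtain ⟨R, hR, hfR⟩ := exists_taylor_remainder hf N
  have h1 : (fun t : ℝ => t ^ N * R t) =O[𝓝 0] fun t => t ^ N := by
    simpa using (isBigO_refl (fun t : ℝ => t ^ N) (𝓝 0)).mul
      (hR.continuous.continuousAt.isBigO_one ℝ)
  have h2 := (h.sub h1).mono (nhdsWithin_le_nhds (s := {0}ᶜ))
  have h3 := eq_zero_of_sum_isBigO (N := N)
    (c := fun i => iteratedDeriv i f 0 / (i.factorial : ℝ) - c i)
    (h2.congr_left fun t => by
      simp only [sub_mul, Finset.sum_sub_distrib]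
      rw [hfR t]
      ring) i hi
  have h4 : (i.factorial : ℝ) ≠ 0 := by positivity
  field_simp at h3
  linarith

/-- The derivative differs from its value at 0 by O(‖x‖); the mean value inequality on the closed
ball of radius ‖p‖ supplies the second factor. -/
theorem isBigO_sub_fderiv {E F : Type*} [NormedAddCommGroup E] [NormedSpace ℝ E]
    [NormedAddCommGroup F] [NormedSpace ℝ F] {Φ : E → F} (hΦ : ContDiff ℝ 2 Φ) :
    (fun p => Φ p - Φ 0 - fderiv ℝ Φ 0 p) =O[𝓝 0] fun p => ‖p‖ ^ 2 := by
  have h1 : DifferentiableAt ℝ (fderiv ℝ Φ) 0 :=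
    (hΦ.fderiv_right (m := 1) le_rfl).differentiable one_ne_zero 0
  obtain ⟨C, hC⟩ := h1.hasFDerivAt.isBigO_sub.bound
  obtain ⟨ε, hε, hball⟩ := Metric.eventually_nhds_iff_ball.1 hC
  refine IsBigO.of_bound |C| ?_
  filter_upwards [Metric.ball_mem_nhds (0 : E) hε] with p hp
  have hp' : ‖p‖ < ε := by simpa using hp
  have hbound : ∀ x ∈ Metric.closedBall (0 : E) ‖p‖,
      ‖fderiv ℝ Φ x - fderiv ℝ Φ 0‖ ≤ |C| * ‖p‖ := by
    intro x hx
    have hx : ‖x‖ ≤ ‖p‖ := by simpa using hx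
    have := hball x (by simpa using hx.trans_lt hp')
    rw [sub_zero] at this
    exact this.trans (mul_le_mul (le_abs_self C) hx (norm_nonneg _) (abs_nonneg C))
  have h2 := (convex_closedBall (0 : E) ‖p‖).norm_image_sub_le_of_norm_hasFDerivWithin_le'
    (f := Φ) (φ := fderiv ℝ Φ 0) (x := 0) (y := p) (C := |C| * ‖p‖)
    (fun x _ => (hΦ.differentiable two_ne_zero x).hasFDerivAt.hasFDerivWithinAt) hbound
    (by simp) (by simp)
  rw [sub_zero] at h2
  rw [norm_pow, norm_norm, sq, ← mul_assoc]
  exact h2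

/-- A germ of a diffeomorphism is represented by a globally smooth map with invertible derivative. -/
theorem IsDiffeoGerm.exists_contDiff {E F : Type*} [NormedAddCommGroup E] [NormedSpace ℝ E]
    [HasContDiffBump E] [NormedAddCommGroup F] [NormedSpace ℝ F] {f : OpenPartialHomeomorph E F}
    {p : E} {q : F} (h : IsDiffeoGerm ∞ f p q) :
    ∃ g : E → F, ContDiff ℝ ∞ g ∧ g p = q ∧ g =ᶠ[𝓝 p] f ∧
      ∃ L : F →L[ℝ] E, L.comp (fderiv ℝ g p) = ContinuousLinearMap.id ℝ E := by
  obtain ⟨hp, rfl, h1, h2⟩ := h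
  obtain ⟨g, hg, hgf⟩ := exists_contDiff_eventuallyEq (n := ⊤) (f.open_source.mem_nhds hp) h1
  refine ⟨g, hg, hgf.eq_of_nhds, hgf, fderiv ℝ f.symm (f p), ?_⟩
  rw [hgf.fderiv_eq]
  have hd1 : DifferentiableAt ℝ f p :=
    (h1.contDiffAt (f.open_source.mem_nhds hp)).differentiableAt (by simp)
  have hd2 : DifferentiableAt ℝ f.symm (f p) :=
    (h2.contDiffAt (f.open_target.mem_nhds (f.map_source hp))).differentiableAt (by simp)
  rw [← fderiv_comp p hd2 hd1]
  have : f.symm ∘ f =ᶠ[𝓝 p] id := by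
    filter_upwards [f.open_source.mem_nhds hp] with x hx using f.left_inv hx
  rw [this.fderiv_eq, fderiv_id]

theorem ContinuousLinearMap.plane_apply (M : Plane →L[ℝ] Plane) (x y : ℝ) (i : Fin 2) :
    M !₂[x, y] i = x * M !₂[1, 0] i + y * M !₂[0, 1] i := by
  have : (!₂[x, y] : Plane) = x • !₂[1, 0] + y • !₂[0, 1] := by
    ext j; fin_cases j <;> simp
  rw [this, map_add, map_smul, map_smul]
  simp

/-- In coordinates this is det L · det M = 1. -/
theorem ContinuousLinearMap.plane_det_ne_zero {M L : Plane →L[ℝ] Plane}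
    (h : L.comp M = ContinuousLinearMap.id ℝ Plane) :
    M !₂[1, 0] 0 * M !₂[0, 1] 1 - M !₂[0, 1] 0 * M !₂[1, 0] 1 ≠ 0 := by
  have h' : ∀ p i, L (!₂[M p 0, M p 1]) i = p i := by
    intro p i
    have : (!₂[M p 0, M p 1] : Plane) = M p := by ext j; fin_cases j <;> simp
    rw [this]
    exact congr_arg (fun q : Plane => q i) (congr_fun (congr_arg DFunLike.coe h) p)
  simp only [L.plane_apply (M _ 0)] at h'
  have h00 := h' !₂[1, 0] 0
  have h01 := h' !₂[1, 0] 1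
  have h10 := h' !₂[0, 1] 0
  have h11 := h' !₂[0, 1] 1
  simp at h00 h01 h10 h11
  intro hdet
  generalize L !₂[1, 0] 0 = l₀ at *
  generalize L !₂[1, 0] 1 = l₁ at *
  generalize L !₂[0, 1] 0 = l₂ at *
  generalize L !₂[0, 1] 1 = l₃ at *
  have : (1 : ℝ) = 0 := by
    linear_combination (l₀ * l₃ - l₂ * l₁) * hdet - h11 * (M !₂[1, 0] 0 * l₀ + M !₂[1, 0] 1 * l₂)
      - h00 + h10 * (M !₂[1, 0] 0 * l₁ + M !₂[1, 0] 1 * l₃)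
  exact one_ne_zero this

/-- Writing s = t V, order 8 requires V^4 modulo t^4, V^5 modulo t^3 and only the constant term of
V^7; the remaining coefficients go into R₅. -/
theorem exists_cuspFamily_comp_expansion {s : ℝ → ℝ} (hs : ContDiff ℝ ∞ s) (hs0 : s 0 = 0) (c : ℝ) :
    ∃ a b d : ℝ, ∃ R₄ R₅ : ℝ → ℝ, Continuous R₄ ∧ Continuous R₅ ∧ ∀ l, l = deriv s 0 →
      (∀ t, s t ^ 4 = l ^ 4 * t ^ 4 + 4 * l ^ 3 * a * t ^ 5 +
        (4 * l ^ 3 * b + 6 * l ^ 2 * a ^ 2) * t ^ 6 +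
        (4 * l ^ 3 * d + 12 * l ^ 2 * a * b + 4 * l * a ^ 3) * t ^ 7 + t ^ 8 * R₄ t) ∧
      ∀ t, s t ^ 5 + c * s t ^ 7 = l ^ 5 * t ^ 5 + 5 * l ^ 4 * a * t ^ 6 +
        (5 * l ^ 4 * b + 10 * l ^ 3 * a ^ 2 + c * l ^ 7) * t ^ 7 + t ^ 8 * R₅ t := by
  obtain ⟨S, hS, hsS⟩ := exists_taylor_remainder hs 5
  obtain ⟨l, a, b, d, hl, hsS⟩ : ∃ l a b d : ℝ, l = deriv s 0 ∧ ∀ t,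
      s t = t * (l + a * t + b * t ^ 2 + d * t ^ 3 + t ^ 4 * S t) :=
    ⟨deriv s 0, iteratedDeriv 2 s 0 / (2).factorial, iteratedDeriv 3 s 0 / (3).factorial,
      iteratedDeriv 4 s 0 / (4).factorial, rfl, fun t => by
      rw [hsS t]
      simp only [Finset.sum_range_succ, Finset.range_zero, Finset.sum_empty, iteratedDeriv_zero,
        hs0, iteratedDeriv_one, Nat.factorial_zero, Nat.factorial_one, Nat.cast_one]
      ring⟩
  obtain ⟨V, hV, hsV⟩ : ∃ V : ℝ → ℝ, HasCubicJet V l a b d ∧ ∀ t, s t = t * V t :=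
    ⟨_, ⟨S, hS.continuous, fun t => rfl⟩, hsS⟩
  have hV2 := hV.mul hV
  have hV4 : HasCubicJet (fun t => V t * V t * (V t * V t)) (l ^ 4) (4 * l ^ 3 * a)
      (4 * l ^ 3 * b + 6 * l ^ 2 * a ^ 2) (4 * l ^ 3 * d + 12 * l ^ 2 * a * b + 4 * l * a ^ 3) := by
    convert hV2.mul hV2 using 1 <;> ring
  obtain ⟨e, hV5⟩ : ∃ e, HasCubicJet (fun t => V t * V t * (V t * V t) * V t) (l ^ 5)
      (5 * l ^ 4 * a) (5 * l ^ 4 * b + 10 * l ^ 3 * a ^ 2) e :=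
    ⟨_, by convert hV4.mul hV using 1 <;> ring⟩
  obtain ⟨e₁, e₂, e₃, hV7⟩ : ∃ e₁ e₂ e₃,
      HasCubicJet (fun t => V t * V t * (V t * V t) * V t * (V t * V t)) (l ^ 7) e₁ e₂ e₃ :=
    ⟨_, _, _, by convert hV5.mul hV2 using 1; ring⟩
  obtain ⟨R₄, hR₄, hV4⟩ := hV4
  obtain ⟨R₅, hR₅, hV5⟩ := hV5
  obtain ⟨R₇, hR₇, hV7⟩ := hV7
  refine ⟨a, b, d, R₄,
    fun t => e + t * R₅ t + c * (e₁ + e₂ * t + e₃ * t ^ 2 + t ^ 3 * R₇ t), hR₄, by fun_prop, ?_⟩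
  rintro _ rfl
  rw [← hl]
  refine ⟨fun t => ?_, fun t => ?_⟩
  · rw [hsV t]
    linear_combination t ^ 4 * hV4 t
  · rw [hsV t]
    linear_combination t ^ 5 * hV5 t + c * t ^ 7 * hV7 t

theorem isBigO_norm_cuspFamily_comp {s : ℝ → ℝ} (hs : ContDiff ℝ ∞ s) (hs0 : s 0 = 0) (c : ℝ) :
    (fun t => ‖cuspFamily c (s t)‖ ^ 2) =O[𝓝 0] fun t => t ^ 8 := by
  have hs8 : s =O[𝓝 0] fun t => t := by
    have := (hs.differentiable (by simp) 0).isBigO_sub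
    simpa [hs0] using this
  have hsc : Continuous s := hs.continuous
  have h1 : (fun t => s t ^ 4) =O[𝓝 0] fun t => t ^ 4 := hs8.pow 4
  have h2 : (fun t => s t ^ 5 + c * s t ^ 7) =O[𝓝 0] fun t => t ^ 4 := by
    have hb : (fun t => s t + c * s t ^ 3) =O[𝓝 0] fun _ => (1 : ℝ) :=
      (by fun_prop : Continuous fun t => s t + c * s t ^ 3).continuousAt.isBigO_one ℝ
    exact ((h1.mul hb).congr_left fun t => by ring).congr_right fun t => mul_one _
  have h3 := (h1.pow 2).add (h2.pow 2)
  refine (h3.congr_left fun t => ?_).congr_right fun t => by ring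
  rw [EuclideanSpace.norm_sq_eq]
  simp [cuspFamily]

/-- The derivatives up to order seven of a curve obtained from `cuspFamily c` by a change of
parameter and a change of coordinates. -/
theorem exists_iteratedDeriv_eq_of_comp_cuspFamily {γ : ℝ → Plane} {Φ : Plane → Plane} {s : ℝ → ℝ}
    {c : ℝ} (hγ : ContDiff ℝ ∞ γ) (hΦ : ContDiff ℝ ∞ Φ) (hs : ContDiff ℝ ∞ s) (hs0 : s 0 = 0)
    (h : ∀ᶠ t in 𝓝 0, γ t = Φ (cuspFamily c (s t))) {l : ℝ} (hl : l = deriv s 0) {u v : Plane}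
    (hu : u = fderiv ℝ Φ 0 !₂[1, 0]) (hv : v = fderiv ℝ Φ 0 !₂[0, 1]) :
    ∃ a b d : ℝ, iteratedDeriv 1 γ 0 = 0 ∧ iteratedDeriv 2 γ 0 = 0 ∧ iteratedDeriv 3 γ 0 = 0 ∧
      ∀ i, iteratedDeriv 4 γ 0 i = 24 * (l ^ 4 * u i) ∧
      iteratedDeriv 5 γ 0 i = 120 * (4 * l ^ 3 * a * u i + l ^ 5 * v i) ∧
      iteratedDeriv 6 γ 0 i = 720 * ((4 * l ^ 3 * b + 6 * l ^ 2 * a ^ 2) * u i +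
        5 * l ^ 4 * a * v i) ∧
      iteratedDeriv 7 γ 0 i = 5040 * ((4 * l ^ 3 * d + 12 * l ^ 2 * a * b + 4 * l * a ^ 3) * u i +
        (5 * l ^ 4 * b + 10 * l ^ 3 * a ^ 2 + c * l ^ 7) * v i) := by
  obtain ⟨a, b, d, R₄, R₅, hR₄, hR₅, hexp⟩ := exists_cuspFamily_comp_expansion hs hs0 c
  obtain ⟨hs4, hs5⟩ := hexp l hl
  let C : Fin 2 → ℕ → ℝ := fun i n =>
    match n with
    | 0 => Φ 0 i
    | 4 => l ^ 4 * u i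
    | 5 => 4 * l ^ 3 * a * u i + l ^ 5 * v i
    | 6 => (4 * l ^ 3 * b + 6 * l ^ 2 * a ^ 2) * u i + 5 * l ^ 4 * a * v i
    | 7 => (4 * l ^ 3 * d + 12 * l ^ 2 * a * b + 4 * l * a ^ 3) * u i +
        (5 * l ^ 4 * b + 10 * l ^ 3 * a ^ 2 + c * l ^ 7) * v i
    | _ => 0
  have hcusp : ∀ i t, Φ 0 i + fderiv ℝ Φ 0 (cuspFamily c (s t)) i -
      ∑ n ∈ Finset.range 8, C i n * t ^ n = t ^ 8 * (u i * R₄ t + v i * R₅ t) := by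
    intro i t
    rw [cuspFamily, (fderiv ℝ Φ 0).plane_apply, ← hu, ← hv, hs4 t, hs5 t]
    simp only [Finset.sum_range_succ, Finset.range_zero, Finset.sum_empty, C]
    ring
  have htendsto : Tendsto (fun t => cuspFamily c (s t)) (𝓝 0) (𝓝 0) := by
    have hzero : cuspFamily c 0 = 0 := by ext i; fin_cases i <;> simp [cuspFamily]
    have := ((contDiff_cuspFamily c (n := 0)).continuous.comp hs.continuous).tendsto 0
    simpa [Function.comp_def, hs0, hzero] using this
  have hderiv : ∀ i, ∀ n < 8, iteratedDeriv n γ 0 i = n.factorial * C i n := by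
    intro i n hn
    rw [iteratedDeriv_plane_coord hγ]
    refine iteratedDeriv_eq_of_isBigO (hγ.plane_coord i) ?_ hn
    -- The curve is O(t^4), so the second-order remainder of Φ is O(t^8) and cannot affect
    -- derivatives up to order 7.
    have h1 : (fun t => Φ (cuspFamily c (s t)) - Φ 0 - fderiv ℝ Φ 0 (cuspFamily c (s t))) =O[𝓝 0]
        fun t => t ^ 8 :=
      ((isBigO_sub_fderiv (by exact_mod_cast contDiff_infty.1 hΦ 2)).comp_tendsto htendsto).trans
        (isBigO_norm_cuspFamily_comp hs hs0 c)
    have h2 : (fun t => (Φ (cuspFamily c (s t)) - Φ 0 -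
        fderiv ℝ Φ 0 (cuspFamily c (s t))) i) =O[𝓝 0] fun t => t ^ 8 :=
      (IsBigO.of_norm_le fun t => PiLp.norm_apply_le _ i).trans h1.norm_left
    have hT : Continuous fun t => u i * R₄ t + v i * R₅ t := by fun_prop
    have h3 : (fun t => t ^ 8 * (u i * R₄ t + v i * R₅ t)) =O[𝓝 0] fun t => t ^ 8 := by
      simpa using (isBigO_refl (fun t : ℝ => t ^ 8) (𝓝 0)).mul (hT.continuousAt.isBigO_one ℝ)
    refine (h2.add h3).congr' ?_ .rfl
    filter_upwards [h] with t ht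
    rw [← hcusp i t, ht]
    simp only [PiLp.sub_apply]
    ring
  refine ⟨a, b, d, ?_, ?_, ?_, fun i => ⟨?_, ?_, ?_, ?_⟩⟩
  · ext i; simpa [C] using hderiv i 1 (by norm_num)
  · ext i; simpa [C] using hderiv i 2 (by norm_num)
  · ext i; simpa [C] using hderiv i 3 (by norm_num)
  · simpa [C, Nat.factorial] using hderiv i 4 (by norm_num)
  · simpa [C, Nat.factorial] using hderiv i 5 (by norm_num)
  · simpa [C, Nat.factorial] using hderiv i 6 (by norm_num)
  · simpa [C, Nat.factorial] using hderiv i 7 (by norm_num)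

theorem AEquivAtZero.cuspidalCurvature_eq {γ : ℝ → Plane} (hγ : ContDiff ℝ ∞ γ) {c : ℝ}
    (h : AEquivAtZero γ (cuspFamily c)) :
    IsFourFiveJet γ ∧ ∃ k, 0 < k ∧ cuspidalCurvature γ = k * c := by
  obtain ⟨ψ, Ψ, hψ, hΨ, h⟩ := CrEquivAtZero.symm h hγ.continuous.continuousAt
  have hzero : cuspFamily c 0 = 0 := by ext i; fin_cases i <;> simp [cuspFamily]
  rw [hzero] at hΨ
  obtain ⟨s, hs, hs0, hsψ, L₁, hL₁⟩ := hψ.symm.exists_contDiff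
  obtain ⟨Φ, hΦ, -, hΦΨ, L₂, hL₂⟩ := hΨ.exists_contDiff
  obtain ⟨l, hl⟩ : ∃ l, l = deriv s 0 := ⟨_, rfl⟩
  have hl0 : l ≠ 0 := by
    rintro h0
    rw [h0] at hl
    have h1 := congr_fun (congr_arg DFunLike.coe hL₁) 1
    rw [ContinuousLinearMap.comp_apply, fderiv_apply_one_eq_deriv, ← hl] at h1
    simp at h1
  have htendsto : Tendsto (fun t => cuspFamily c (s t)) (𝓝 0) (𝓝 0) := by
    have := ((contDiff_cuspFamily c (n := 0)).continuous.comp hs.continuous).tendsto 0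
    simpa [Function.comp_def, hs0, hzero] using this
  have hγΦ : ∀ᶠ t in 𝓝 0, γ t = Φ (cuspFamily c (s t)) := by
    filter_upwards [h, hsψ, htendsto.eventually hΦΨ] with t h1 h2 h3
    rw [h3, h2, h1]
  obtain ⟨a, b, d, h1, h2, h3, hder⟩ :=
    exists_iteratedDeriv_eq_of_comp_cuspFamily hγ hΦ hs hs0 hγΦ hl rfl rfl
  have hdet := (fderiv ℝ Φ 0).plane_det_ne_zero hL₂
  generalize fderiv ℝ Φ 0 !₂[1, 0] = u at hder hdet
  generalize fderiv ℝ Φ 0 !₂[0, 1] = v at hder hdet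
  have h4 := fun i => (hder i).1
  have h5 := fun i => (hder i).2.1
  have h6 := fun i => (hder i).2.2.1
  have h7 := fun i => (hder i).2.2.2
  have hA : cuspA γ = -(2880 * l ^ 9 * (u 0 * v 1 - v 0 * u 1)) := by
    rw [cuspA, jetDet_eq, h4, h4, h5, h5]
    ring
  have hA0 : cuspA γ ≠ 0 := by
    rw [hA]
    exact neg_ne_zero.2 (mul_ne_zero (mul_ne_zero (by norm_num) (pow_ne_zero _ hl0)) hdet)
  have hv4 : iteratedDeriv 4 γ 0 ≠ 0 := by
    intro h0
    apply hA0
    rw [cuspA, jetDet_eq, h0]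
    simp
  -- The terms in a and b cancel between B^2, A D and A C. What remains is the c-term of 60 A C,
  -- with constant 60 · (24 · 120) · (24 · 5040); l and the determinant enter with even exponents.
  refine ⟨⟨h1, h2, h3, hA0⟩, 20901888000 * l ^ 20 * (u 0 * v 1 - v 0 * u 1) ^ 2 /
      ‖iteratedDeriv 4 γ 0‖ ^ 5, ?_, ?_⟩
  · have := norm_pos_iff.2 hv4
    positivity
  · rw [cuspidalCurvature, div_mul_eq_mul_div]
    congr 1
    simp only [cuspA, cuspB, cuspC, cuspD, jetDet_eq, h4, h5, h6, h7]
    ring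

/-! ### C^1-equivalence of the models -/

theorem hasDerivAt_mul_abs_rpow (y : ℝ) :
    HasDerivAt (fun y : ℝ => y * |y| ^ (2 / 5 : ℝ)) (7 / 5 * |y| ^ (2 / 5 : ℝ)) y := by
  rcases eq_or_ne y 0 with rfl | hy
  · have h0 : Tendsto (fun y : ℝ => |y| ^ (2 / 5 : ℝ)) (𝓝 0) (𝓝 0) := by
      have : Continuous fun y : ℝ => |y| ^ (2 / 5 : ℝ) :=
        continuous_abs.rpow_const fun _ => .inr (by norm_num)
      simpa using this.tendsto 0
    rw [hasDerivAt_iff_isLittleO]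
    have h1 := (isBigO_refl (fun y : ℝ => y) (𝓝 0)).mul_isLittleO
      ((isLittleO_one_iff ℝ).2 h0)
    simpa using h1
  · have hy' : 0 < |y| := abs_pos.2 hy
    have h1 := (hasDerivAt_id y).mul
      ((hasDerivAt_abs hy).rpow_const (p := 2 / 5) (.inl hy'.ne'))
    refine h1.congr_deriv ?_
    have h2 : y * (SignType.sign y : ℝ) = |y| := self_mul_sign y
    have h3 : |y| ^ (2 / 5 : ℝ) = |y| * |y| ^ (2 / 5 - 1 : ℝ) := by
      rw [mul_comm, ← Real.rpow_add_one hy'.ne']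
      norm_num
    simp only [id, one_mul]
    linear_combination (2 / 5 * |y| ^ (2 / 5 - 1 : ℝ)) * h2 - 2 / 5 * h3

theorem contDiff_mul_abs_rpow : ContDiff ℝ 1 fun y : ℝ => y * |y| ^ (2 / 5 : ℝ) := by
  refine contDiff_one_iff_deriv.2 ⟨fun y => (hasDerivAt_mul_abs_rpow y).differentiableAt, ?_⟩
  rw [show deriv _ = _ from funext fun y => (hasDerivAt_mul_abs_rpow y).deriv]
  exact (continuous_abs.rpow_const fun _ => .inr (by norm_num)).const_mul _

theorem crEquivAtZero_one_cuspFamily (c : ℝ) :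
    CrEquivAtZero 1 (cuspFamily 0) (cuspFamily c) := by
  have hy : ContDiff ℝ 1 fun p : Plane => p 1 := contDiff_plane_apply 1
  have hzero : cuspFamily 0 0 = 0 := by ext i; fin_cases i <;> simp [cuspFamily]
  refine CrEquivAtZero.of_maps le_rfl contDiff_id rfl (hasDerivAt_id 0) one_ne_zero
    (Φ := fun p => !₂[p 0 + 0, p 1 + c * (p 1 * |p 1| ^ (2 / 5 : ℝ))]) (Φ' := .refl ℝ Plane)
    (contDiff_plane_mk ((contDiff_plane_apply 0).add contDiff_const)
      (hy.add (contDiff_const.mul (contDiff_mul_abs_rpow.comp hy)))) ?_ ?_ ?_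
  · ext i; fin_cases i <;> simp [cuspFamily]
  · rw [hzero]
    refine hasFDerivAt_plane_mk (hasFDerivAt_const _ _) ?_
    have h1 : HasDerivAt (fun y : ℝ => y * |y| ^ (2 / 5 : ℝ)) 0 ((0 : Plane) 1) := by
      simpa using hasDerivAt_mul_abs_rpow 0
    have h2 := (h1.comp_hasFDerivAt (0 : Plane)
      (hy.differentiable one_ne_zero 0).hasFDerivAt).const_mul c
    exact h2.congr_fderiv (by simp)
  · refine .of_forall fun t => ?_
    have h : |t ^ 5| ^ (2 / 5 : ℝ) = t ^ 2 := by
      rw [abs_pow, ← Real.rpow_natCast, ← Real.rpow_mul (abs_nonneg t), ← sq_abs t,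
        ← Real.rpow_natCast |t| 2]
      norm_num
    ext i; fin_cases i
    · simp [cuspFamily]
    · simp only [cuspFamily, id, Fin.mk_one, Matrix.cons_val_one, Matrix.cons_val_fin_one,
        zero_mul, add_zero, h]
      ring

/-! ### Classification by the sign of the curvature -/

theorem cusp45_eq : cusp45 = cuspFamily 0 := by
  funext t; simp [cusp45, cuspFamily]

theorem cusp45Plus_eq : cusp45Plus = cuspFamily 1 := by
  funext t; simp [cusp45Plus, cuspFamily]

theorem cusp45Minus_eq : cusp45Minus = cuspFamily (-1) := by
  funext t; simp [cusp45Minus, cuspFamily, sub_eq_add_neg]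

/-- A curve with the right jet is equivalent to some `cuspFamily d` with d in {0, 1, -1}; its
curvature has the sign of d, and signs separate these three values. Only the germ at 0 matters, so γ
may be replaced by a globally smooth curve. -/
theorem aEquivAtZero_cuspFamily_iff {γ : ℝ → Plane} {I : Set ℝ} (hI : I ∈ 𝓝 0)
    (hγ : ContDiffOn ℝ ∞ γ I) {c : ℝ} (hc : c = 0 ∨ c = 1 ∨ c = -1) :
    AEquivAtZero γ (cuspFamily c) ↔
      IsFourFiveJet γ ∧ SignType.sign (cuspidalCurvature γ) = SignType.sign c := by
  have key : ∀ {γ : ℝ → Plane}, ContDiff ℝ ∞ γ → ∀ {c : ℝ}, AEquivAtZero γ (cuspFamily c) →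
      IsFourFiveJet γ ∧ SignType.sign (cuspidalCurvature γ) = SignType.sign c := by
    intro γ hγ c h
    obtain ⟨hj, k, hk, h⟩ := h.cuspidalCurvature_eq hγ
    rw [h, sign_mul, sign_pos hk, one_mul]
    exact ⟨hj, rfl⟩
  obtain ⟨δ, hδ, hδγ⟩ := exists_contDiff_eventuallyEq (n := ⊤) hI hγ
  have hderiv : ∀ n, iteratedDeriv n γ 0 = iteratedDeriv n δ 0 := fun n =>
    (hδγ.iteratedDeriv_eq n).symm
  have hequiv : AEquivAtZero γ (cuspFamily c) ↔ AEquivAtZero δ (cuspFamily c) :=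
    ⟨fun h => CrEquivAtZero.congr_left h hδγ.symm, fun h => CrEquivAtZero.congr_left h hδγ⟩
  have hjet : ∀ i j, jetDet γ i j = jetDet δ i j := fun i j => by
    rw [jetDet, jetDet, hderiv, hderiv]
  have hjet' : IsFourFiveJet γ ↔ IsFourFiveJet δ := by
    simp only [IsFourFiveJet, cuspA, hderiv, hjet]
  have hcurv : cuspidalCurvature γ = cuspidalCurvature δ := by
    simp only [cuspidalCurvature, cuspA, cuspB, cuspC, cuspD, hderiv, hjet]
  rw [hequiv, hjet', hcurv]
  refine ⟨key hδ, fun ⟨h, hs⟩ => ?_⟩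
  obtain ⟨d, hd, hδd⟩ := h.exists_aEquivAtZero_cuspFamily hδ
  have : SignType.sign d = SignType.sign c := (key hδ hδd).2.symm.trans hs
  have hdc : d = c := by
    rcases hd with rfl | rfl | rfl <;> rcases hc with rfl | rfl | rfl <;> simp at this ⊢
  exact hdc ▸ hδd

theorem not_aEquivAtZero_cuspFamily {c d : ℝ} (hc : c = 0 ∨ c = 1 ∨ c = -1)
    (hd : d = 0 ∨ d = 1 ∨ d = -1) (hcd : SignType.sign c ≠ SignType.sign d) :
    ¬ AEquivAtZero (cuspFamily c) (cuspFamily d) := by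
  intro h
  have h1 := (aEquivAtZero_cuspFamily_iff univ_mem (contDiff_cuspFamily c).contDiffOn hd).1 h
  have h2 := (aEquivAtZero_cuspFamily_iff univ_mem (contDiff_cuspFamily c).contDiffOn hc).1
    (CrEquivAtZero.refl _)
  exact hcd (h2.2.symm.trans h1.2)

theorem theorem4p8 :
    (∀ (I : Set ℝ) (γ : ℝ → Plane), IsOpen I → I.OrdConnected → (0 : ℝ) ∈ I →
      ContDiffOn ℝ ∞ γ I →
        (AEquivAtZero γ cusp45 ↔ IsFourFiveJet γ ∧ cuspidalCurvature γ = 0) ∧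
        (AEquivAtZero γ cusp45Plus ↔ IsFourFiveJet γ ∧ 0 < cuspidalCurvature γ) ∧
        (AEquivAtZero γ cusp45Minus ↔ IsFourFiveJet γ ∧ cuspidalCurvature γ < 0)) ∧
    (¬ AEquivAtZero cusp45 cusp45Plus ∧
      ¬ AEquivAtZero cusp45 cusp45Minus ∧
      ¬ AEquivAtZero cusp45Plus cusp45Minus) ∧
    (CrEquivAtZero 1 cusp45 cusp45Plus ∧
      CrEquivAtZero 1 cusp45 cusp45Minus ∧
      CrEquivAtZero 1 cusp45Plus cusp45Minus) := by
  rw [cusp45_eq, cusp45Plus_eq, cusp45Minus_eq]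
  refine ⟨fun I γ hI _ h0 hγ => ?_, ⟨?_, ?_, ?_⟩,
    crEquivAtZero_one_cuspFamily 1, crEquivAtZero_one_cuspFamily (-1),
    ((crEquivAtZero_one_cuspFamily 1).symm
      (contDiff_cuspFamily 0 (n := 0)).continuous.continuousAt).trans
        (crEquivAtZero_one_cuspFamily (-1))⟩
  · have hI' := hI.mem_nhds h0
    refine ⟨?_, ?_, ?_⟩
    · rw [aEquivAtZero_cuspFamily_iff hI' hγ (.inl rfl), sign_zero, sign_eq_zero_iff]
    · rw [aEquivAtZero_cuspFamily_iff hI' hγ (.inr (.inl rfl)), sign_one, sign_eq_one_iff]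
    · rw [aEquivAtZero_cuspFamily_iff hI' hγ (.inr (.inr rfl)), sign_neg (neg_one_lt_zero (R := ℝ)),
        sign_eq_neg_one_iff]
  · exact not_aEquivAtZero_cuspFamily (by simp) (by simp) (by simp)
  · exact not_aEquivAtZero_cuspFamily (by simp) (by simp) (by simp)
  · exact not_aEquivAtZero_cuspFamily (by simp) (by simp) (by simp)
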